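/- **Fundamental property of the Kripke logical relation for Async RaTT.** *Types.* Closed types are generated by $A,B ::= \alpha \mid 1 \mid \mathsf{Nat} \mid A\times B \mid A+B \mid A\to B \mid \bigcirc_\exists A \mid \bigcirc_\forall A \mid \mathsf{Fix}\,\alpha.A \mid \Box A$. Stable types: $S ::= 1 \mid \mathsf{Nat}\mid S\times S'\mid S+S'\mid \bigcirc_\forall A\mid \Box A$. Value types: $T ::= 1\mid\mathsf{Nat}\mid T\times T'\mid T+T'$. *Syntax.* Fix a set of channels $\kappa$. A clock is a finite set of channels; every heap location $l$ has a clock $\mathrm{cl}(l)$, and each clock has countably infinitely many locations. Values are $v ::= x\mid ()\mid 0\mid \mathsf{suc}\,v\mid\lambda x.t\mid\langle v,w\rangle\mid\mathsf{in}_i v\mid l\mid \mathsf{inp}_\kappa\mid\mathsf{box}\,t\mid\mathsf{dfix}\,x.t\mid\mathsf{into}\,v$; terms are generated by values, $\mathsf{suc}\,t$, $\mathsf{rec}(s,xy.t,u)$, $\langle s,t\rangle$, $\mathsf{in}_i t$, $\pi_i t$, $s\,t$, $\mathsf{let}\,x=s\,\mathsf{in}\,t$, $\mathsf{case}\,t\,\mathsf{of}\,\mathsf{in}_1x.t_1;\mathsf{in}_2x.t_2$,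 $\mathsf{delay}_\theta t$, $\mathsf{adv}\,t$, $\mathsf{select}\,v_1v_2$, $\mathsf{unbox}\,t$, $\mathsf{fix}\,x.t$, $\mathsf{never}$, $\mathsf{buf}_\kappa$, $\mathsf{into}\,t$, $\mathsf{out}\,t$. Clock expressions: $\theta ::= \mathrm{cl}(v)\mid\theta\sqcup\theta'$, with $[\![\mathrm{cl}(l)]\!]=\mathrm{cl}(l)$, $[\![\mathrm{cl}(\mathsf{inp}_\kappa)]\!]=\{\kappa\}$, $[\![\theta\sqcup\theta']\!]=[\![\theta]\!]\cup[\![\theta']\!]$ (undefined otherwise). *Typing.* An input context $\Delta$ consists of declarations $\kappa:_cA$ with $A$ a value type and $c\in\{\mathsf p,\mathsf b,\mathsf{bp}\}$, at most one per channel; $\Delta(\kappa)=A$. Push channels are those with $c\in\{\mathsf p,\mathsf{bp}\}$ (they form $\mathrm{dom}_p\Delta$), buffered ones those with $c\in\{\mathsf b,\mathsf{bp}\}$. Contexts $\Gamma$ are lists of variable declarations $x:A$ and ticks $\checkmark_\theta$. $\Gamma^\Box$ is $\Gamma$ without its ticks and its variables of non-stable type. Simultaneously define: $\Gamma$ is well-formed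 if its variables are distinct and each decomposition $\Gamma=\Gamma_1,\checkmark_\theta,\Gamma_2$ has $\Gamma_1$ tick-free with $\Gamma_1\vdash\theta$ clock; $\Gamma\vdash\mathrm{cl}(v)$ clock if $v$ is a value with $\Gamma\vdash v:\bigcirc_\exists A$ for some $A$, and clocks are closed under $\sqcup$; and $\Gamma\vdash t:A$ (relative to $\Delta$) by the usual rules for $1,\mathsf{Nat},\times,+$, application and $\mathsf{let}$, together with: - $\Gamma,x{:}A,\Gamma'\vdash x:A$ if this context is well-formed and $\Gamma'$ is tick-free or $A$ is stable; - $\Gamma\vdash\lambda x.t:A\to B$ if $\Gamma,x{:}A\vdash t:B$ and $\Gamma$ is tick-free; - $\Gamma\vdash\mathsf{delay}_\theta t:\bigcirc_\exists A$ if $\Gamma\vdash\theta$ clock and $\Gamma,\checkmark_\theta\vdash t:A$; $\Gamma\vdash\mathsf{never}:\bigcirc_\exists A$; - for $\kappa:_cA\in\Delta$: $\Gamma\vdash\mathsf{inp}_\kappa:\bigcirc_\exists A$ if $\kappa$ is push, $\Gamma\vdash\mathsf{buf}_\kappa:A$ if $\kappa$ is buffered; - if $\Gamma,\checkmark_\theta,\Gamma'$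 is well-formed: $\Gamma,\checkmark_\theta,\Gamma'\vdash\mathsf{adv}\,v:A$ if $v$ is a value, $\Gamma\vdash v:\bigcirc_\exists A$ and $\theta=\mathrm{cl}(v)$; $\Gamma,\checkmark_\theta,\Gamma'\vdash\mathsf{adv}\,x:A$ if $\Gamma\vdash x:\bigcirc_\forall A$; and $\Gamma,\checkmark_\theta,\Gamma'\vdash\mathsf{select}\,v_1v_2:((A_1\times\bigcirc_\exists A_2)+(\bigcirc_\exists A_1\times A_2))+(A_1\times A_2)$ if $v_1,v_2$ are values, $\Gamma\vdash v_i:\bigcirc_\exists A_i$ and $\theta=\mathrm{cl}(v_1)\sqcup\mathrm{cl}(v_2)$ up to associativity, commutativity and idempotence of $\sqcup$; - $\Gamma\vdash\mathsf{fix}\,x.t:A$ if $\Gamma^\Box,x{:}\bigcirc_\forall A\vdash t:A$; $\Gamma\vdash\mathsf{box}\,t:\Box A$ if $\Gamma^\Box\vdash t:A$; $\Gamma\vdash\mathsf{unbox}\,t:A$ if $\Gamma\vdash t:\Box A$; - $\mathsf{into}$ and $\mathsf{out}$ convert between $A[\bigcirc_\exists(\mathsf{Fix}\,\alpha.A)/\alpha]$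 and $\mathsf{Fix}\,\alpha.A$. Write $\vdash v:A$ if $v$ is a value typed in the empty context and empty input context; $\iota:\Delta$ if $\iota(\kappa)$ is defined with $\vdash\iota(\kappa):A$ for each buffered $\kappa:_cA\in\Delta$. *Stores.* A heap $\eta$ is a finite map from locations to terms; $\eta\in\mathrm{Heap}^\kappa$ if $\kappa\in\mathrm{cl}(l)$ for all $l\in\mathrm{dom}\,\eta$. A store $\sigma$ is a heap $\eta_L$ or $\eta_N\langle\kappa\mapsto v\rangle\eta_L$ with $\eta_N\in\mathrm{Heap}^\kappa$ and a term $v$; $\mathrm{gc}(\sigma)=\eta_L$ in both cases. $[\eta]_{\kappa\in}$ and $[\eta]_{\kappa\notin}$ are the parts of $\eta$ with $\kappa\in\mathrm{cl}(l)$, resp. $\kappa\notin\mathrm{cl}(l)$. $\eta|_\Theta$ keeps the locations with $\mathrm{cl}(l)\subseteq\Theta$, and $(\eta_N\langle\kappa\mapsto v\rangle\eta_L)|_\Theta$ is $\eta_N|_\Theta\langle\kappa\mapsto v\rangle\eta_L|_\Theta$ if $\kappa\in\Theta$ and $\eta_L|_\Theta$ otherwise. $\eta\sqsubseteq\eta'$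 if $\eta'$ extends $\eta$; $\eta_N\langle\kappa\mapsto v\rangle\eta_L\sqsubseteq\eta_N'\langle\kappa\mapsto v\rangle\eta_L'$ if $\eta_N\sqsubseteq\eta_N'$ and $\eta_L\sqsubseteq\eta_L'$. $\sigma\sqsubseteq^\checkmark_\Delta\sigma'$ if $\sigma\sqsubseteq\sigma'$, or $\sigma=\eta_L$, $\sigma'=\eta_N\langle\kappa\mapsto v\rangle\eta_L'$ with $\eta_L\sqsubseteq\eta_L'$, $\kappa$ declared in $\Delta$ and $\vdash v:\Delta(\kappa)$. *Evaluation.* Fix any allocation function giving, for each clock $\Theta$ and store $\sigma$, a location $\mathrm{alloc}^\Theta(\sigma)\notin\mathrm{dom}(\mathrm{gc}(\sigma))$ with clock $\Theta$. $\langle t;\sigma\rangle\Downarrow^\iota\langle v;\sigma'\rangle$ is the usual left-to-right call-by-value big-step semantics, threading the store (values evaluate to themselves; $\mathsf{unbox}\,t$ evaluates $t$ to $\mathsf{box}\,t'$ and then $t'$; $\mathsf{into}\,t$ evaluates $t$ under $\mathsf{into}$, and $\mathsf{out}$ removes $\mathsf{into}$), with: $\mathsf{buf}_\kappa$ yields $\iota(\kappa)$;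 $\mathsf{delay}_\theta t$ yields $l=\mathrm{alloc}^{[\![\theta]\!]}(\sigma)$ and adds $l\mapsto t$ to the later heap; $\mathsf{never}$ yields $\mathrm{alloc}^\emptyset(\sigma)$ with the store unchanged; $\mathsf{fix}\,x.t$ and $\mathsf{adv}(\mathsf{dfix}\,x.t)$ evaluate $t[\mathsf{dfix}\,x.t/x]$; and in a store $\eta_N\langle\kappa\mapsto w\rangle\eta_L$, $\mathsf{adv}\,\mathsf{inp}_\kappa$ yields $w$, $\mathsf{adv}\,l$ evaluates $\eta_N(l)$, and $\mathsf{select}\,v_1v_2$ yields $\mathsf{in}_1(\mathsf{in}_1\langle u_1,v_2\rangle)$, $\mathsf{in}_1(\mathsf{in}_2\langle v_1,u_2\rangle)$ or $\mathsf{in}_2\langle u_1,u_2\rangle$ according to whether $\kappa$ lies in $[\![\mathrm{cl}(v_1)]\!]$ only, in $[\![\mathrm{cl}(v_2)]\!]$ only, or in both, where $u_i$ is the result of $\mathsf{adv}\,v_i$ (for both, $v_1$ is advanced first). *Logical relation.* By recursion on $n$ and then on the size of the type define sets of closed values $\mathcal V[\![A]\!](n,\sigma)$, with $$\mathcal T[\![A]\!](n,\sigma)=\{t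 \text{ closed}\mid\forall\iota:\Delta.\ \forall\sigma'\sqsupseteq^\checkmark_\Delta\sigma.\ \exists\sigma'',v.\ \langle t;\sigma'\rangle\Downarrow^\iota\langle v;\sigma''\rangle\wedge v\in\mathcal V[\![A]\!](n,\sigma'')\}.$$ $\mathcal V[\![1]\!]=\{()\}$; $\mathcal V[\![\mathsf{Nat}]\!]$ is the set of numerals; products and sums are componentwise at the same $(n,\sigma)$; - $\mathcal V[\![A\to B]\!](n,\sigma)=\{\lambda x.t\mid\forall\sigma'\sqsupseteq^\checkmark_\Delta\mathrm{gc}(\sigma),\,n'\le n,\,v\in\mathcal V[\![A]\!](n',\sigma').\ t[v/x]\in\mathcal T[\![B]\!](n',\sigma')\}$; - $\mathcal V[\![\Box A]\!](n,\sigma)=\{\mathsf{box}\,t\mid t\in\mathcal T[\![A]\!](n,\emptyset)\}$; - $\mathcal V[\![\bigcirc_\forall A]\!](0,\sigma)$ is the set of all closed $\mathsf{dfix}\,x.t$, and $\mathcal V[\![\bigcirc_\forall A]\!](n+1,\sigma)=\{\mathsf{dfix}\,x.t\mid t[\mathsf{dfix}\,x.t/x]\in\mathcal T[\![A]\!](n,\emptyset)\}$;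 - $\mathcal V[\![\bigcirc_\exists A]\!](n,\sigma)$ contains $\mathsf{inp}_\kappa$ for each push channel $\kappa:_cA\in\Delta$ and those locations $l$ with $\mathrm{cl}(l)\subseteq\mathrm{dom}_p\Delta$ that, if $n=m+1$, satisfy: for all $\kappa\in\mathrm{cl}(l)$ and $\vdash v:\Delta(\kappa)$, with $\eta=\mathrm{gc}(\sigma)$, $\eta(l)$ is defined and $\eta(l)\in\mathcal T[\![A]\!](m,([\eta]_{\kappa\in}\langle\kappa\mapsto v\rangle[\eta]_{\kappa\notin})|_{\mathrm{cl}(l)})$; - $\mathcal V[\![\mathsf{Fix}\,\alpha.A]\!](n,\sigma)=\{\mathsf{into}\,v\mid v\in\mathcal V[\![A[\bigcirc_\exists(\mathsf{Fix}\,\alpha.A)/\alpha]]\!](n,\sigma)\}$. For environments, every $\gamma$ is in $\mathcal C[\![\cdot]\!](n,\sigma)$; $\gamma[x\mapsto v]\in\mathcal C[\![\Gamma,x:A]\!](n,\sigma)$ iff $\gamma\in\mathcal C[\![\Gamma]\!](n,\sigma)$ and $v\in\mathcal V[\![A]\!](n,\sigma)$; and $\gamma\in\mathcal C[\![\Gamma,\checkmark_\theta]\!](n,\sigma)$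 iff $\sigma=\eta_N\langle\kappa\mapsto v\rangle\eta_L$ is a two-heap store, $\Theta=[\![\theta\gamma]\!]$ is defined, $\kappa\in\Theta\subseteq\mathrm{dom}_p\Delta$, $\vdash v:\Delta(\kappa)$, and there are heaps $\eta_N'\in\mathrm{Heap}^\kappa$ and $\eta_L'$ with $\eta_N|_\Theta=\eta_N'|_\Theta$, $\eta_L|_\Theta=\eta_L'|_\Theta$ and $\gamma\in\mathcal C[\![\Gamma]\!](n+1,\eta_N'\cup[\eta_L']_{\kappa\notin})$. **Theorem.** Let $\Delta$ be an input context, $n\in\mathbb N$, and $\sigma$ a store whose input value, if it has one, is well-typed (i.e. if $\sigma=\eta_N\langle\kappa\mapsto v\rangle\eta_L$, then $\kappa$ is declared in $\Delta$ and $\vdash v:\Delta(\kappa)$). If $\Gamma$ is well-formed, $\Gamma\vdash t:A$ and $\gamma\in\mathcal C[\![\Gamma]\!](n,\sigma)$, then $t\gamma\in\mathcal T[\![A]\!](n,\sigma)$. -/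

import Mathlib

universe u

namespace AsyncRaTT

/-! ## Types -/

/-- Types with at most `n` free type variables (de Bruijn indices); `Ty 0` are the closed types.
`delayE` is the asynchronous delay on an existentially quantified clock, `delayA` the delay on
all clocks, `box` the stability modality and `fix` the guarded recursive type. -/
inductive Ty : ℕ → Type
  | tvar {n : ℕ} (i : Fin n) : Ty n
  | unit {n : ℕ} : Ty n
  | nat {n : ℕ} : Ty n
  | prod {n : ℕ} (A B : Ty n) : Ty n
  | sum {n : ℕ} (A B : Ty n) : Ty n
  | arrow {n : ℕ} (A B : Ty n) : Ty n
  | delayE {n : ℕ} (A : Ty n) : Ty n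
  | delayA {n : ℕ} (A : Ty n) : Ty n
  | fix {n : ℕ} (A : Ty (n + 1)) : Ty n
  | box {n : ℕ} (A : Ty n) : Ty n

namespace Ty

/-- Lift a renaming of type variables under a binder. -/
def upRen {n m : ℕ} (ρ : Fin n → Fin m) : Fin (n + 1) → Fin (m + 1) :=
  Fin.cases 0 (fun i => (ρ i).succ)

def rename : {n : ℕ} → Ty n → {m : ℕ} → (Fin n → Fin m) → Ty m
  | _, tvar i, _, ρ => tvar (ρ i)
  | _, unit, _, _ => unit
  | _, nat, _, _ => nat
  | _, prod A B, _, ρ => prod (A.rename ρ) (B.rename ρ)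
  | _, sum A B, _, ρ => sum (A.rename ρ) (B.rename ρ)
  | _, arrow A B, _, ρ => arrow (A.rename ρ) (B.rename ρ)
  | _, delayE A, _, ρ => delayE (A.rename ρ)
  | _, delayA A, _, ρ => delayA (A.rename ρ)
  | _, fix A, _, ρ => fix (A.rename (upRen ρ))
  | _, box A, _, ρ => box (A.rename ρ)

/-- Lift a substitution of types for type variables under a binder. -/
def upSub {n m : ℕ} (s : Fin n → Ty m) : Fin (n + 1) → Ty (m + 1) :=
  Fin.cases (tvar 0) (fun i => (s i).rename Fin.succ)

def subst : {n : ℕ} → Ty n → {m : ℕ} → (Fin n → Ty m) → Ty m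
  | _, tvar i, _, s => s i
  | _, unit, _, _ => unit
  | _, nat, _, _ => nat
  | _, prod A B, _, s => prod (A.subst s) (B.subst s)
  | _, sum A B, _, s => sum (A.subst s) (B.subst s)
  | _, arrow A B, _, s => arrow (A.subst s) (B.subst s)
  | _, delayE A, _, s => delayE (A.subst s)
  | _, delayA A, _, s => delayA (A.subst s)
  | _, fix A, _, s => fix (A.subst (upSub s))
  | _, box A, _, s => box (A.subst s)

/-- `A[B/α]`, where `α` is the last bound type variable of `A`. -/
def inst {n : ℕ} (A : Ty (n + 1)) (B : Ty n) : Ty n :=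
  A.subst (Fin.cases B tvar)

/-- The unfolding `A[◯∃(Fix α.A)/α]` of the recursive type `Fix α.A`. -/
def unfold {n : ℕ} (A : Ty (n + 1)) : Ty n :=
  A.inst (delayE (fix A))

/-- Stable types. -/
def isStable : {n : ℕ} → Ty n → Bool
  | _, unit => true
  | _, nat => true
  | _, prod A B => A.isStable && B.isStable
  | _, sum A B => A.isStable && B.isStable
  | _, delayA _ => true
  | _, box _ => true
  | _, _ => false

/-- Value types, the types of the data on input channels. -/
def isValueType : {n : ℕ} → Ty n → Bool
  | _, unit => true
  | _, nat => true
  | _, prod A B => A.isValueType && B.isValueType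
  | _, sum A B => A.isValueType && B.isValueType
  | _, _ => false

/-- The size of types used in the recursive definition of the logical relation. -/
def size : {n : ℕ} → Ty n → ℕ
  | _, tvar _ => 1
  | _, unit => 1
  | _, nat => 1
  | _, prod A B => 1 + A.size + B.size
  | _, sum A B => 1 + A.size + B.size
  | _, arrow A B => 1 + A.size + B.size
  | _, delayE _ => 1
  | _, delayA _ => 1
  | _, fix A => 1 + A.size
  | _, box A => 1 + A.size

theorem size_rename : {n : ℕ} → (A : Ty n) → {m : ℕ} → (ρ : Fin n → Fin m) →
    (A.rename ρ).size = A.size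
  | _, tvar _, _, _ => rfl
  | _, unit, _, _ => rfl
  | _, nat, _, _ => rfl
  | _, prod A B, _, ρ => by simp [rename, size, size_rename A ρ, size_rename B ρ]
  | _, sum A B, _, ρ => by simp [rename, size, size_rename A ρ, size_rename B ρ]
  | _, arrow A B, _, ρ => by simp [rename, size, size_rename A ρ, size_rename B ρ]
  | _, delayE _, _, _ => rfl
  | _, delayA _, _, _ => rfl
  | _, fix A, _, ρ => by simp [rename, size, size_rename A (upRen ρ)]
  | _, box A, _, ρ => by simp [rename, size, size_rename A ρ]

theorem size_subst : {n : ℕ} → (A : Ty n) → {m : ℕ} → (s : Fin n → Ty m) →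
    (∀ i, (s i).size = 1) → (A.subst s).size = A.size
  | _, tvar i, _, _, h => h i
  | _, unit, _, _, _ => rfl
  | _, nat, _, _, _ => rfl
  | _, prod A B, _, s, h => by simp [subst, size, size_subst A s h, size_subst B s h]
  | _, sum A B, _, s, h => by simp [subst, size, size_subst A s h, size_subst B s h]
  | _, arrow A B, _, s, h => by simp [subst, size, size_subst A s h, size_subst B s h]
  | _, delayE _, _, _, _ => rfl
  | _, delayA _, _, _, _ => rfl
  | _, fix A, _, s, h => by
    have h' : ∀ i, (upSub s i).size = 1 := by
      intro i
      refine Fin.cases ?_ (fun j => ?_) i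
      · rfl
      · simp [upSub, size_rename, h j]
    simp [subst, size, size_subst A (upSub s) h']
  | _, box A, _, s, h => by simp [subst, size, size_subst A s h]

theorem size_unfold {n : ℕ} (A : Ty (n + 1)) : A.unfold.size = A.size := by
  refine size_subst A _ (fun i => ?_)
  refine Fin.cases ?_ (fun j => ?_) i
  · rfl
  · rfl

end Ty

/-! ## Channels, locations, terms -/

/-- Heap locations. Every location `l` carries a clock `cl(l)`, a finite set of channels, and
for each clock there are countably infinitely many locations. -/
@[ext]
structure Loc (Chan : Type u) where
  clock : Finset Chan
  idx : ℕ

mutual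

/-- Terms; variables are de Bruijn indices. Binders: `lam`, `dfix`, `fix` and the second argument
of `letIn` bind one variable, as do both branches of `case`; in `natrec s t n`, for
`rec_Nat(s, x y. t, n)`, the term `t` binds two variables, `y` being index `0` and `x` index `1`.
`inp κ` refers to the next value pushed on `κ`, `buf κ` reads the buffered value of `κ`.
That the arguments of `select` and of `cl` are values is enforced by the typing rules, and for
evaluation these arguments have to be locations or channels. -/
inductive Tm (Chan : Type u) : Type u
  | var (i : ℕ) : Tm Chan
  | unit : Tm Chan
  | zero : Tm Chan
  | suc (t : Tm Chan) : Tm Chan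
  | natrec (s t n : Tm Chan) : Tm Chan
  | lam (t : Tm Chan) : Tm Chan
  | app (s t : Tm Chan) : Tm Chan
  | letIn (s t : Tm Chan) : Tm Chan
  | pair (s t : Tm Chan) : Tm Chan
  | fst (t : Tm Chan) : Tm Chan
  | snd (t : Tm Chan) : Tm Chan
  | inl (t : Tm Chan) : Tm Chan
  | inr (t : Tm Chan) : Tm Chan
  | case (t t₁ t₂ : Tm Chan) : Tm Chan
  | loc (l : Loc Chan) : Tm Chan
  | inp (κ : Chan) : Tm Chan
  | buf (κ : Chan) : Tm Chan
  | delay (θ : Clk Chan) (t : Tm Chan) : Tm Chan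
  | adv (t : Tm Chan) : Tm Chan
  | select (v₁ v₂ : Tm Chan) : Tm Chan
  | never : Tm Chan
  | box (t : Tm Chan) : Tm Chan
  | unbox (t : Tm Chan) : Tm Chan
  | fix (t : Tm Chan) : Tm Chan
  | dfix (t : Tm Chan) : Tm Chan
  | into (t : Tm Chan) : Tm Chan
  | out (t : Tm Chan) : Tm Chan

/-- Clock expressions `cl(v)` and `θ ⊔ θ'`. -/
inductive Clk (Chan : Type u) : Type u
  | cl (v : Tm Chan) : Clk Chan
  | join (θ θ' : Clk Chan) : Clk Chan

end

/-- Lift a renaming of variables under a binder. -/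
def upRen (ρ : ℕ → ℕ) : ℕ → ℕ
  | 0 => 0
  | i + 1 => ρ i + 1

section Syn

variable {Chan : Type u}

mutual

def Tm.rename : Tm Chan → (ℕ → ℕ) → Tm Chan
  | .var i, ρ => .var (ρ i)
  | .unit, _ => .unit
  | .zero, _ => .zero
  | .suc t, ρ => .suc (t.rename ρ)
  | .natrec s t n, ρ => .natrec (s.rename ρ) (t.rename (upRen (upRen ρ))) (n.rename ρ)
  | .lam t, ρ => .lam (t.rename (upRen ρ))
  | .app s t, ρ => .app (s.rename ρ) (t.rename ρ)
  | .letIn s t, ρ => .letIn (s.rename ρ) (t.rename (upRen ρ))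
  | .pair s t, ρ => .pair (s.rename ρ) (t.rename ρ)
  | .fst t, ρ => .fst (t.rename ρ)
  | .snd t, ρ => .snd (t.rename ρ)
  | .inl t, ρ => .inl (t.rename ρ)
  | .inr t, ρ => .inr (t.rename ρ)
  | .case t t₁ t₂, ρ => .case (t.rename ρ) (t₁.rename (upRen ρ)) (t₂.rename (upRen ρ))
  | .loc l, _ => .loc l
  | .inp κ, _ => .inp κ
  | .buf κ, _ => .buf κ
  | .delay θ t, ρ => .delay (θ.rename ρ) (t.rename ρ)
  | .adv t, ρ => .adv (t.rename ρ)
  | .select v₁ v₂, ρ => .select (v₁.rename ρ) (v₂.rename ρ)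
  | .never, _ => .never
  | .box t, ρ => .box (t.rename ρ)
  | .unbox t, ρ => .unbox (t.rename ρ)
  | .fix t, ρ => .fix (t.rename (upRen ρ))
  | .dfix t, ρ => .dfix (t.rename (upRen ρ))
  | .into t, ρ => .into (t.rename ρ)
  | .out t, ρ => .out (t.rename ρ)

def Clk.rename : Clk Chan → (ℕ → ℕ) → Clk Chan
  | .cl v, ρ => .cl (v.rename ρ)
  | .join θ θ', ρ => .join (θ.rename ρ) (θ'.rename ρ)

end

/-- The substitution (or environment) with `v` for the most recent variable and `s` for the
others. -/
def scons (v : Tm Chan) (s : ℕ → Tm Chan) : ℕ → Tm Chan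
  | 0 => v
  | i + 1 => s i

/-- Lift a substitution under a binder. -/
def upSub (s : ℕ → Tm Chan) : ℕ → Tm Chan :=
  scons (.var 0) (fun i => (s i).rename Nat.succ)

mutual

/-- Simultaneous capture-avoiding substitution. -/
def Tm.subst : Tm Chan → (ℕ → Tm Chan) → Tm Chan
  | .var i, s => s i
  | .unit, _ => .unit
  | .zero, _ => .zero
  | .suc t, s => .suc (t.subst s)
  | .natrec r t n, s => .natrec (r.subst s) (t.subst (upSub (upSub s))) (n.subst s)
  | .lam t, s => .lam (t.subst (upSub s))
  | .app r t, s => .app (r.subst s) (t.subst s)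
  | .letIn r t, s => .letIn (r.subst s) (t.subst (upSub s))
  | .pair r t, s => .pair (r.subst s) (t.subst s)
  | .fst t, s => .fst (t.subst s)
  | .snd t, s => .snd (t.subst s)
  | .inl t, s => .inl (t.subst s)
  | .inr t, s => .inr (t.subst s)
  | .case t t₁ t₂, s => .case (t.subst s) (t₁.subst (upSub s)) (t₂.subst (upSub s))
  | .loc l, _ => .loc l
  | .inp κ, _ => .inp κ
  | .buf κ, _ => .buf κ
  | .delay θ t, s => .delay (θ.subst s) (t.subst s)
  | .adv t, s => .adv (t.subst s)
  | .select v₁ v₂, s => .select (v₁.subst s) (v₂.subst s)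
  | .never, _ => .never
  | .box t, s => .box (t.subst s)
  | .unbox t, s => .unbox (t.subst s)
  | .fix t, s => .fix (t.subst (upSub s))
  | .dfix t, s => .dfix (t.subst (upSub s))
  | .into t, s => .into (t.subst s)
  | .out t, s => .out (t.subst s)

def Clk.subst : Clk Chan → (ℕ → Tm Chan) → Clk Chan
  | .cl v, s => .cl (v.subst s)
  | .join θ θ', s => .join (θ.subst s) (θ'.subst s)

end

/-- `t[v/x]` for the most recently bound variable `x`. -/
def Tm.inst (t v : Tm Chan) : Tm Chan :=
  t.subst (scons v Tm.var)

/-- `t[v/x, w/y]` for `x` of index `1` and `y` of index `0`. -/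
def Tm.inst₂ (t v w : Tm Chan) : Tm Chan :=
  t.subst (scons w (scons v Tm.var))

mutual

/-- All free variables are smaller than `k`. -/
def Tm.FreeBelow : Tm Chan → ℕ → Prop
  | .var i, k => i < k
  | .unit, _ => True
  | .zero, _ => True
  | .suc t, k => t.FreeBelow k
  | .natrec s t n, k => s.FreeBelow k ∧ t.FreeBelow (k + 2) ∧ n.FreeBelow k
  | .lam t, k => t.FreeBelow (k + 1)
  | .app s t, k => s.FreeBelow k ∧ t.FreeBelow k
  | .letIn s t, k => s.FreeBelow k ∧ t.FreeBelow (k + 1)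
  | .pair s t, k => s.FreeBelow k ∧ t.FreeBelow k
  | .fst t, k => t.FreeBelow k
  | .snd t, k => t.FreeBelow k
  | .inl t, k => t.FreeBelow k
  | .inr t, k => t.FreeBelow k
  | .case t t₁ t₂, k => t.FreeBelow k ∧ t₁.FreeBelow (k + 1) ∧ t₂.FreeBelow (k + 1)
  | .loc _, _ => True
  | .inp _, _ => True
  | .buf _, _ => True
  | .delay θ t, k => θ.FreeBelow k ∧ t.FreeBelow k
  | .adv t, k => t.FreeBelow k
  | .select v₁ v₂, k => v₁.FreeBelow k ∧ v₂.FreeBelow k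
  | .never, _ => True
  | .box t, k => t.FreeBelow k
  | .unbox t, k => t.FreeBelow k
  | .fix t, k => t.FreeBelow (k + 1)
  | .dfix t, k => t.FreeBelow (k + 1)
  | .into t, k => t.FreeBelow k
  | .out t, k => t.FreeBelow k

def Clk.FreeBelow : Clk Chan → ℕ → Prop
  | .cl v, k => v.FreeBelow k
  | .join θ θ', k => θ.FreeBelow k ∧ θ'.FreeBelow k

end

/-- Closed terms. -/
def Tm.Closed (t : Tm Chan) : Prop := t.FreeBelow 0

/-- Values. -/
inductive IsValue : Tm Chan → Prop
  | var (i : ℕ) : IsValue (.var i)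
  | unit : IsValue .unit
  | zero : IsValue .zero
  | suc {v : Tm Chan} : IsValue v → IsValue (.suc v)
  | lam (t : Tm Chan) : IsValue (.lam t)
  | pair {v w : Tm Chan} : IsValue v → IsValue w → IsValue (.pair v w)
  | inl {v : Tm Chan} : IsValue v → IsValue (.inl v)
  | inr {v : Tm Chan} : IsValue v → IsValue (.inr v)
  | loc (l : Loc Chan) : IsValue (.loc l)
  | inp (κ : Chan) : IsValue (.inp κ)
  | box (t : Tm Chan) : IsValue (.box t)
  | dfix (t : Tm Chan) : IsValue (.dfix t)
  | into {v : Tm Chan} : IsValue v → IsValue (.into v)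

/-- The numeral `suc^m 0`. -/
def numeral : ℕ → Tm Chan
  | 0 => .zero
  | m + 1 => .suc (numeral m)

end Syn

/-! ## Typing -/

/-- Push-only, buffered-only, and buffered push channels. -/
inductive ChanKind : Type
  | p
  | b
  | bp

/-- Kinds of push channels. -/
def ChanKind.isPush : ChanKind → Prop
  | .p => True
  | .b => False
  | .bp => True

/-- Kinds of buffered channels. -/
def ChanKind.isBuffered : ChanKind → Prop
  | .p => False
  | .b => True
  | .bp => True

/-- Input contexts `Δ`: partial maps from channels to a kind and a value type;
`decl κ = some (c, A)` is the declaration `κ :_c A ∈ Δ`. -/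
structure InputCtx (Chan : Type u) where
  decl : Chan → Option (ChanKind × Ty 0)
  valueType : ∀ κ c A, decl κ = some (c, A) → A.isValueType = true

/-- The input context without declarations. -/
def InputCtx.empty (Chan : Type u) : InputCtx Chan where
  decl := fun _ => none
  valueType := by intro κ c A h; cases h

/-- `dom_p(Δ)`, the push channels of `Δ`. -/
def InputCtx.pushDom {Chan : Type u} (Δ : InputCtx Chan) : Set Chan :=
  {κ | ∃ c A, Δ.decl κ = some (c, A) ∧ c.isPush}

/-- Entries of typing contexts: a variable of a given type, or a tick `✓θ`. -/
inductive Entry (Chan : Type u) : Type u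
  | var (A : Ty 0) : Entry Chan
  | tick (θ : Clk Chan) : Entry Chan

/-- Typing contexts; the head of the list is the most recent entry, so that the context written
`Γ, Γ'` is the list `Γ' ++ Γ`. Variable indices count the `var` entries only. -/
abbrev Ctx (Chan : Type u) := List (Entry Chan)

section Typing

variable {Chan : Type u}

/-- The number of variables declared in a context. -/
def numVars : Ctx Chan → ℕ
  | [] => 0
  | .var _ :: Γ => numVars Γ + 1
  | .tick _ :: Γ => numVars Γ

def TickFree : Ctx Chan → Prop
  | [] => True
  | .var _ :: Γ => TickFree Γ
  | .tick _ :: _ => False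

/-- The stabilisation `Γ^□`: all ticks and all variables of non-stable type are removed. -/
def stabilize : Ctx Chan → Ctx Chan
  | [] => []
  | .var A :: Γ => if A.isStable = true then .var A :: stabilize Γ else stabilize Γ
  | .tick _ :: Γ => stabilize Γ

/-- The inclusion of the variables of `Γ^□` into those of `Γ`, in terms of indices. -/
def stabEmb : Ctx Chan → ℕ → ℕ
  | [] => id
  | .var A :: Γ => if A.isStable = true then upRen (stabEmb Γ) else fun i => stabEmb Γ i + 1
  | .tick _ :: Γ => stabEmb Γ

/-- Equality of clock expressions: `⊔` is associative, commutative and idempotent. -/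
inductive ClkEq : Clk Chan → Clk Chan → Prop
  | refl (θ : Clk Chan) : ClkEq θ θ
  | symm {θ θ' : Clk Chan} : ClkEq θ θ' → ClkEq θ' θ
  | trans {θ₁ θ₂ θ₃ : Clk Chan} : ClkEq θ₁ θ₂ → ClkEq θ₂ θ₃ → ClkEq θ₁ θ₃
  | congr {θ₁ θ₁' θ₂ θ₂' : Clk Chan} : ClkEq θ₁ θ₁' → ClkEq θ₂ θ₂' →
      ClkEq (.join θ₁ θ₂) (.join θ₁' θ₂')
  | assoc (θ₁ θ₂ θ₃ : Clk Chan) :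
      ClkEq (.join (.join θ₁ θ₂) θ₃) (.join θ₁ (.join θ₂ θ₃))
  | comm (θ θ' : Clk Chan) : ClkEq (.join θ θ') (.join θ' θ)
  | idem (θ : Clk Chan) : ClkEq (.join θ θ) θ

mutual

/-- `Γ` is a well-formed context. -/
inductive WfCtx (Δ : InputCtx Chan) : Ctx Chan → Prop
  | nil : WfCtx Δ []
  | var {Γ : Ctx Chan} {A : Ty 0} : WfCtx Δ Γ → WfCtx Δ (.var A :: Γ)
  | tick {Γ : Ctx Chan} {θ : Clk Chan} :
      WfCtx Δ Γ → IsClock Δ Γ θ → TickFree Γ → WfCtx Δ (.tick θ :: Γ)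

/-- `θ` is a clock expression in context `Γ`. -/
inductive IsClock (Δ : InputCtx Chan) : Ctx Chan → Clk Chan → Prop
  | join {Γ : Ctx Chan} {θ θ' : Clk Chan} :
      IsClock Δ Γ θ → IsClock Δ Γ θ' → IsClock Δ Γ (.join θ θ')
  | cl {Γ : Ctx Chan} {v : Tm Chan} {A : Ty 0} :
      IsValue v → HasType Δ Γ v (.delayE A) → IsClock Δ Γ (.cl v)

/-- The typing judgement `Γ ⊢_Δ t : A`. Where the named presentation uses a term of a context
in an extension of that context, its variables are renumbered here. -/
inductive HasType (Δ : InputCtx Chan) : Ctx Chan → Tm Chan → Ty 0 → Prop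
  | var {Γ Γ' : Ctx Chan} {A : Ty 0} :
      TickFree Γ' ∨ A.isStable = true → WfCtx Δ (Γ' ++ .var A :: Γ) →
      HasType Δ (Γ' ++ .var A :: Γ) (.var (numVars Γ')) A
  | unit {Γ : Ctx Chan} : HasType Δ Γ .unit .unit
  | letIn {Γ : Ctx Chan} {s t : Tm Chan} {A B : Ty 0} :
      HasType Δ Γ s A → HasType Δ (.var A :: Γ) t B → HasType Δ Γ (.letIn s t) B
  | lam {Γ : Ctx Chan} {t : Tm Chan} {A B : Ty 0} :
      HasType Δ (.var A :: Γ) t B → TickFree Γ → HasType Δ Γ (.lam t) (.arrow A B)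
  | app {Γ : Ctx Chan} {s t : Tm Chan} {A B : Ty 0} :
      HasType Δ Γ s (.arrow A B) → HasType Δ Γ t A → HasType Δ Γ (.app s t) B
  | inl {Γ : Ctx Chan} {t : Tm Chan} {A B : Ty 0} :
      HasType Δ Γ t A → HasType Δ Γ (.inl t) (.sum A B)
  | inr {Γ : Ctx Chan} {t : Tm Chan} {A B : Ty 0} :
      HasType Δ Γ t B → HasType Δ Γ (.inr t) (.sum A B)
  | case {Γ : Ctx Chan} {t t₁ t₂ : Tm Chan} {A₁ A₂ B : Ty 0} :
      HasType Δ (.var A₁ :: Γ) t₁ B → HasType Δ (.var A₂ :: Γ) t₂ B →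
      HasType Δ Γ t (.sum A₁ A₂) → HasType Δ Γ (.case t t₁ t₂) B
  | pair {Γ : Ctx Chan} {s t : Tm Chan} {A B : Ty 0} :
      HasType Δ Γ s A → HasType Δ Γ t B → HasType Δ Γ (.pair s t) (.prod A B)
  | fst {Γ : Ctx Chan} {t : Tm Chan} {A B : Ty 0} :
      HasType Δ Γ t (.prod A B) → HasType Δ Γ (.fst t) A
  | snd {Γ : Ctx Chan} {t : Tm Chan} {A B : Ty 0} :
      HasType Δ Γ t (.prod A B) → HasType Δ Γ (.snd t) B
  | delay {Γ : Ctx Chan} {θ : Clk Chan} {t : Tm Chan} {A : Ty 0} :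
      HasType Δ (.tick θ :: Γ) t A → IsClock Δ Γ θ → HasType Δ Γ (.delay θ t) (.delayE A)
  | never {Γ : Ctx Chan} {A : Ty 0} : HasType Δ Γ .never (.delayE A)
  | inp {Γ : Ctx Chan} {κ : Chan} {c : ChanKind} {A : Ty 0} :
      Δ.decl κ = some (c, A) → c.isPush → HasType Δ Γ (.inp κ) (.delayE A)
  | buf {Γ : Ctx Chan} {κ : Chan} {c : ChanKind} {A : Ty 0} :
      Δ.decl κ = some (c, A) → c.isBuffered → HasType Δ Γ (.buf κ) A
  | adv {Γ Γ' : Ctx Chan} {v : Tm Chan} {A : Ty 0} :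
      IsValue v → HasType Δ Γ v (.delayE A) → WfCtx Δ (Γ' ++ .tick (.cl v) :: Γ) →
      HasType Δ (Γ' ++ .tick (.cl v) :: Γ) (.adv (v.rename (fun i => i + numVars Γ'))) A
  | select {Γ Γ' : Ctx Chan} {θ : Clk Chan} {v₁ v₂ : Tm Chan} {A₁ A₂ : Ty 0} :
      IsValue v₁ → IsValue v₂ →
      HasType Δ Γ v₁ (.delayE A₁) → HasType Δ Γ v₂ (.delayE A₂) →
      ClkEq θ (.join (.cl v₁) (.cl v₂)) → WfCtx Δ (Γ' ++ .tick θ :: Γ) →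
      HasType Δ (Γ' ++ .tick θ :: Γ)
        (.select (v₁.rename (fun i => i + numVars Γ')) (v₂.rename (fun i => i + numVars Γ')))
        (.sum (.sum (.prod A₁ (.delayE A₂)) (.prod (.delayE A₁) A₂)) (.prod A₁ A₂))
  | zero {Γ : Ctx Chan} : HasType Δ Γ .zero .nat
  | suc {Γ : Ctx Chan} {t : Tm Chan} : HasType Δ Γ t .nat → HasType Δ Γ (.suc t) .nat
  | natrec {Γ : Ctx Chan} {s t n : Tm Chan} {A : Ty 0} :
      HasType Δ Γ s A → HasType Δ (.var A :: .var .nat :: Γ) t A → HasType Δ Γ n .nat →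
      HasType Δ Γ (.natrec s t n) A
  | fix {Γ : Ctx Chan} {t : Tm Chan} {A : Ty 0} :
      HasType Δ (.var (.delayA A) :: stabilize Γ) t A →
      HasType Δ Γ (.fix (t.rename (upRen (stabEmb Γ)))) A
  | advA {Γ Γ' : Ctx Chan} {θ : Clk Chan} {i : ℕ} {A : Ty 0} :
      HasType Δ Γ (.var i) (.delayA A) → WfCtx Δ (Γ' ++ .tick θ :: Γ) →
      HasType Δ (Γ' ++ .tick θ :: Γ) (.adv (.var (i + numVars Γ'))) A
  | box {Γ : Ctx Chan} {t : Tm Chan} {A : Ty 0} :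
      HasType Δ (stabilize Γ) t A → HasType Δ Γ (.box (t.rename (stabEmb Γ))) (.box A)
  | unbox {Γ : Ctx Chan} {t : Tm Chan} {A : Ty 0} :
      HasType Δ Γ t (.box A) → HasType Δ Γ (.unbox t) A
  | out {Γ : Ctx Chan} {t : Tm Chan} {A : Ty 1} :
      HasType Δ Γ t (.fix A) → HasType Δ Γ (.out t) A.unfold
  | into {Γ : Ctx Chan} {t : Tm Chan} {A : Ty 1} :
      HasType Δ Γ t A.unfold → HasType Δ Γ (.into t) (.fix A)

end

/-- `⊢ v : A` for a value `v`, in the empty typing context and the empty input context. -/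
def ValueOfType (v : Tm Chan) (A : Ty 0) : Prop :=
  IsValue v ∧ HasType (InputCtx.empty Chan) [] v A

/-- `⊢ κ ↦ v : Δ`: the channel `κ` is declared in `Δ` and `⊢ v : Δ(κ)`. -/
def InputOk (Δ : InputCtx Chan) (κ : Chan) (v : Tm Chan) : Prop :=
  ∃ c A, Δ.decl κ = some (c, A) ∧ ValueOfType v A

/-- Input buffers `ι`, the current values of buffered channels. -/
abbrev Buffer (Chan : Type u) := Chan → Option (Tm Chan)

/-- `ι : Δ`. -/
def BufferOk (Δ : InputCtx Chan) (ι : Buffer Chan) : Prop :=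
  ∀ κ c A, Δ.decl κ = some (c, A) → c.isBuffered → ∃ v, ι κ = some v ∧ ValueOfType v A

end Typing

/-! ## Heaps and stores -/

/-- Heaps: finite maps from locations to terms. -/
@[ext]
structure Heap (Chan : Type u) where
  get : Loc Chan → Option (Tm Chan)
  finite_dom : {l | get l ≠ none}.Finite

namespace Heap

variable {Chan : Type u}

def dom (η : Heap Chan) : Set (Loc Chan) := {l | η.get l ≠ none}

def empty : Heap Chan where
  get := fun _ => none
  finite_dom := by simp

open Classical in
/-- `η, l ↦ t` -/
noncomputable def insert (η : Heap Chan) (l : Loc Chan) (t : Tm Chan) : Heap Chan where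
  get := fun l' => if l' = l then some t else η.get l'
  finite_dom := by
    refine (η.finite_dom.insert l).subset ?_
    intro l' hl'
    by_cases h : l' = l
    · exact Or.inl h
    · exact Or.inr (by simpa [h] using hl')

open Classical in
/-- The heap `η` restricted to the locations that satisfy `P`. -/
noncomputable def filter (P : Loc Chan → Prop) (η : Heap Chan) : Heap Chan where
  get := fun l => if P l then η.get l else none
  finite_dom := by
    refine η.finite_dom.subset ?_
    intro l hl h
    exact hl (by simp [h])

/-- The union `(η₁, η₂)`, used for heaps with disjoint domains only. -/
def union (η₁ η₂ : Heap Chan) : Heap Chan where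
  get := fun l => (η₁.get l).or (η₂.get l)
  finite_dom := by
    refine (η₁.finite_dom.union η₂.finite_dom).subset ?_
    intro l hl
    by_contra h
    simp only [Set.mem_union, Set.mem_ofPred_eq, not_or, not_not] at h
    exact hl (by simp [h.1, h.2])

/-- The part of `η` with the locations whose clock contains `κ`. -/
noncomputable def withChan (κ : Chan) (η : Heap Chan) : Heap Chan :=
  η.filter (fun l => κ ∈ l.clock)

/-- The part of `η` with the locations whose clock does not contain `κ`. -/
noncomputable def withoutChan (κ : Chan) (η : Heap Chan) : Heap Chan :=
  η.filter (fun l => κ ∉ l.clock)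

/-- The part of `η` with the locations whose clock is contained in `Θ`. -/
noncomputable def restr (Θ : Finset Chan) (η : Heap Chan) : Heap Chan :=
  η.filter (fun l => l.clock ⊆ Θ)

/-- `η ∈ Heap^κ`: the clocks of all locations in `η` contain `κ`. -/
def OnChan (κ : Chan) (η : Heap Chan) : Prop := ∀ l ∈ η.dom, κ ∈ l.clock

/-- The order `⊑` on heaps. -/
def le (η η' : Heap Chan) : Prop := ∀ l ∈ η.dom, η.get l = η'.get l

theorem dom_filter_subset (P : Loc Chan → Prop) (η : Heap Chan) {l : Loc Chan}
    (hl : l ∈ (η.filter P).dom) : P l ∧ l ∈ η.dom := by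
  by_cases h : P l
  · exact ⟨h, by simpa [dom, filter, h] using hl⟩
  · exact absurd hl (by simp [dom, filter, h])

theorem onChan_withChan (κ : Chan) (η : Heap Chan) : OnChan κ (η.withChan κ) :=
  fun _ hl => (dom_filter_subset _ η hl).1

theorem OnChan.restr {κ : Chan} {η : Heap Chan} (h : OnChan κ η) (Θ : Finset Chan) :
    OnChan κ (η.restr Θ) :=
  fun l hl => h l (dom_filter_subset _ η hl).2

end Heap

/-- Stores: a single later heap `η_L`, or `η_N ⟨κ ↦ v⟩ η_L` with a now heap `η_N ∈ Heap^κ`, an input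
value `v` on `κ`, and a later heap. -/
inductive Store (Chan : Type u) : Type u
  | later (ηL : Heap Chan) : Store Chan
  | ticked (ηN : Heap Chan) (κ : Chan) (v : Tm Chan) (ηL : Heap Chan)
      (onChan : Heap.OnChan κ ηN) : Store Chan

namespace Store

variable {Chan : Type u}

/-- The empty store. -/
def empty : Store Chan := .later .empty

/-- Garbage collection, that is, the later heap of a store. -/
def gc : Store Chan → Heap Chan
  | .later ηL => ηL
  | .ticked _ _ _ ηL _ => ηL

/-- `σ, l ↦ t`: extension of the later heap. -/
noncomputable def insert : Store Chan → Loc Chan → Tm Chan → Store Chan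
  | .later ηL, l, t => .later (ηL.insert l t)
  | .ticked ηN κ v ηL h, l, t => .ticked ηN κ v (ηL.insert l t) h

/-- The store that results from the heap `η` when the input `κ ↦ v` arrives. -/
noncomputable def receive (η : Heap Chan) (κ : Chan) (v : Tm Chan) : Store Chan :=
  .ticked (η.withChan κ) κ v (η.withoutChan κ) (Heap.onChan_withChan κ η)

open Classical in
/-- Restriction of a store to the locations whose clocks are subclocks of `Θ`. -/
noncomputable def restr (Θ : Finset Chan) : Store Chan → Store Chan
  | .later ηL => .later (ηL.restr Θ)
  | .ticked ηN κ v ηL h =>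
      if κ ∈ Θ then .ticked (ηN.restr Θ) κ v (ηL.restr Θ) (h.restr Θ) else .later (ηL.restr Θ)

/-- The order `⊑` on stores: allocation. -/
inductive Le : Store Chan → Store Chan → Prop
  | later {ηL ηL' : Heap Chan} : ηL.le ηL' → Le (.later ηL) (.later ηL')
  | ticked {ηN ηN' ηL ηL' : Heap Chan} {κ : Chan} {v : Tm Chan}
      {h : Heap.OnChan κ ηN} {h' : Heap.OnChan κ ηN'} : ηN.le ηN' → ηL.le ηL' →
      Le (.ticked ηN κ v ηL h) (.ticked ηN' κ v ηL' h')

/-- The order `⊑✓_Δ` on stores: allocation, possibly together with the arrival of an input. -/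
inductive TickLe (Δ : InputCtx Chan) : Store Chan → Store Chan → Prop
  | le {σ σ' : Store Chan} : Le σ σ' → TickLe Δ σ σ'
  | input {ηN ηL ηL' : Heap Chan} {κ : Chan} {v : Tm Chan} {h : Heap.OnChan κ ηN} :
      ηL.le ηL' → InputOk Δ κ v → TickLe Δ (.later ηL) (.ticked ηN κ v ηL' h)

/-- The input value held by the store, if any, is a well-typed input for `Δ`. -/
def InputTyped (Δ : InputCtx Chan) : Store Chan → Prop
  | .later _ => True
  | .ticked _ κ v _ _ => InputOk Δ κ v

end Store

/-! ## Evaluation semantics -/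

/-- An allocation function: for every clock and store, a location on that clock which is fresh
for the later heap of the store. -/
structure Allocator (Chan : Type u) where
  alloc : Finset Chan → Store Chan → Loc Chan
  clock_alloc : ∀ Θ σ, (alloc Θ σ).clock = Θ
  fresh : ∀ Θ σ, alloc Θ σ ∉ σ.gc.dom

theorem Allocator.exists_fresh {Chan : Type u} (Θ : Finset Chan) (η : Heap Chan) :
    ∃ l : Loc Chan, l.clock = Θ ∧ l ∉ η.dom := by
  have hinj : Function.Injective (fun i : ℕ => (⟨Θ, i⟩ : Loc Chan)) := by
    intro i j h
    exact congrArg Loc.idx h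
  obtain ⟨l, ⟨i, rfl⟩, hl⟩ :=
    ((Set.infinite_range_of_injective hinj).sdiff η.finite_dom).nonempty
  exact ⟨_, rfl, hl⟩

instance {Chan : Type u} : Nonempty (Allocator Chan) :=
  ⟨{ alloc := fun Θ σ => (Allocator.exists_fresh Θ σ.gc).choose
     clock_alloc := fun Θ σ => (Allocator.exists_fresh Θ σ.gc).choose_spec.1
     fresh := fun Θ σ => (Allocator.exists_fresh Θ σ.gc).choose_spec.2 }⟩

section Semantics

variable {Chan : Type u}

open Classical in
/-- The clock `⟦θ⟧` denoted by a closed clock expression, if defined. -/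
noncomputable def Clk.eval : Clk Chan → Option (Finset Chan)
  | .cl (.loc l) => some l.clock
  | .cl (.inp κ) => some {κ}
  | .cl _ => none
  | .join θ θ' =>
    match θ.eval, θ'.eval with
    | some Θ, some Θ' => some (Θ ∪ Θ')
    | _, _ => none

/-- Big-step evaluation: `Eval al ι t σ v σ'` says that `t` with store `σ` and input buffer `ι`
evaluates to `v` with store `σ'`. -/
inductive Eval (al : Allocator Chan) (ι : Buffer Chan) :
    Tm Chan → Store Chan → Tm Chan → Store Chan → Prop
  | value {v : Tm Chan} {σ : Store Chan} : IsValue v → Eval al ι v σ v σ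
  | pair {t t' v v' : Tm Chan} {σ σ' σ'' : Store Chan} :
      Eval al ι t σ v σ' → Eval al ι t' σ' v' σ'' →
      Eval al ι (.pair t t') σ (.pair v v') σ''
  | fst {t v₁ v₂ : Tm Chan} {σ σ' : Store Chan} :
      Eval al ι t σ (.pair v₁ v₂) σ' → Eval al ι (.fst t) σ v₁ σ'
  | snd {t v₁ v₂ : Tm Chan} {σ σ' : Store Chan} :
      Eval al ι t σ (.pair v₁ v₂) σ' → Eval al ι (.snd t) σ v₂ σ'
  | inl {t v : Tm Chan} {σ σ' : Store Chan} :
      Eval al ι t σ v σ' → Eval al ι (.inl t) σ (.inl v) σ'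
  | inr {t v : Tm Chan} {σ σ' : Store Chan} :
      Eval al ι t σ v σ' → Eval al ι (.inr t) σ (.inr v) σ'
  | case_inl {t t₁ t₂ v w : Tm Chan} {σ σ' σ'' : Store Chan} :
      Eval al ι t σ (.inl v) σ' → Eval al ι (t₁.inst v) σ' w σ'' →
      Eval al ι (.case t t₁ t₂) σ w σ''
  | case_inr {t t₁ t₂ v w : Tm Chan} {σ σ' σ'' : Store Chan} :
      Eval al ι t σ (.inr v) σ' → Eval al ι (t₂.inst v) σ' w σ'' →
      Eval al ι (.case t t₁ t₂) σ w σ''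
  | app {t t' s v w : Tm Chan} {σ σ' σ'' σ''' : Store Chan} :
      Eval al ι t σ (.lam s) σ' → Eval al ι t' σ' v σ'' →
      Eval al ι (s.inst v) σ'' w σ''' → Eval al ι (.app t t') σ w σ'''
  | letIn {s t v w : Tm Chan} {σ σ' σ'' : Store Chan} :
      Eval al ι s σ v σ' → Eval al ι (t.inst v) σ' w σ'' → Eval al ι (.letIn s t) σ w σ''
  | buf {κ : Chan} {v : Tm Chan} {σ : Store Chan} :
      ι κ = some v → Eval al ι (.buf κ) σ v σ
  | delay {θ : Clk Chan} {Θ : Finset Chan} {t : Tm Chan} {σ : Store Chan} :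
      θ.eval = some Θ →
      Eval al ι (.delay θ t) σ (.loc (al.alloc Θ σ)) (σ.insert (al.alloc Θ σ) t)
  | never {σ : Store Chan} : Eval al ι .never σ (.loc (al.alloc ∅ σ)) σ
  | adv_inp {κ : Chan} {v : Tm Chan} {ηN ηL : Heap Chan} {h : Heap.OnChan κ ηN} :
      Eval al ι (.adv (.inp κ)) (.ticked ηN κ v ηL h) v (.ticked ηN κ v ηL h)
  | adv_loc {l : Loc Chan} {t : Tm Chan} {κ : Chan} {v w : Tm Chan} {ηN ηL : Heap Chan}
      {h : Heap.OnChan κ ηN} {σ' : Store Chan} :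
      ηN.get l = some t → Eval al ι t (.ticked ηN κ v ηL h) w σ' →
      Eval al ι (.adv (.loc l)) (.ticked ηN κ v ηL h) w σ'
  | select_left {v₁ v₂ u₁ w : Tm Chan} {Θ₁ Θ₂ : Finset Chan} {κ : Chan} {ηN ηL : Heap Chan}
      {h : Heap.OnChan κ ηN} {σ' : Store Chan} :
      (Clk.cl v₁).eval = some Θ₁ → (Clk.cl v₂).eval = some Θ₂ → κ ∈ Θ₁ → κ ∉ Θ₂ →
      Eval al ι (.adv v₁) (.ticked ηN κ w ηL h) u₁ σ' →
      Eval al ι (.select v₁ v₂) (.ticked ηN κ w ηL h) (.inl (.inl (.pair u₁ v₂))) σ'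
  | select_right {v₁ v₂ u₂ w : Tm Chan} {Θ₁ Θ₂ : Finset Chan} {κ : Chan} {ηN ηL : Heap Chan}
      {h : Heap.OnChan κ ηN} {σ' : Store Chan} :
      (Clk.cl v₁).eval = some Θ₁ → (Clk.cl v₂).eval = some Θ₂ → κ ∉ Θ₁ → κ ∈ Θ₂ →
      Eval al ι (.adv v₂) (.ticked ηN κ w ηL h) u₂ σ' →
      Eval al ι (.select v₁ v₂) (.ticked ηN κ w ηL h) (.inl (.inr (.pair v₁ u₂))) σ'
  | select_both {v₁ v₂ u₁ u₂ w : Tm Chan} {Θ₁ Θ₂ : Finset Chan} {κ : Chan} {ηN ηL : Heap Chan}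
      {h : Heap.OnChan κ ηN} {σ' σ'' : Store Chan} :
      (Clk.cl v₁).eval = some Θ₁ → (Clk.cl v₂).eval = some Θ₂ → κ ∈ Θ₁ → κ ∈ Θ₂ →
      Eval al ι (.adv v₁) (.ticked ηN κ w ηL h) u₁ σ' → Eval al ι (.adv v₂) σ' u₂ σ'' →
      Eval al ι (.select v₁ v₂) (.ticked ηN κ w ηL h) (.inr (.pair u₁ u₂)) σ''
  | suc {t v : Tm Chan} {σ σ' : Store Chan} :
      Eval al ι t σ v σ' → Eval al ι (.suc t) σ (.suc v) σ'
  | natrec_zero {s t n v : Tm Chan} {σ σ' σ'' : Store Chan} :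
      Eval al ι n σ .zero σ' → Eval al ι s σ' v σ'' → Eval al ι (.natrec s t n) σ v σ''
  | natrec_suc {s t n v v' w : Tm Chan} {σ σ' σ'' σ''' : Store Chan} :
      Eval al ι n σ (.suc v) σ' → Eval al ι (.natrec s t v) σ' v' σ'' →
      Eval al ι (t.inst₂ v v') σ'' w σ''' → Eval al ι (.natrec s t n) σ w σ'''
  | adv_dfix {t v : Tm Chan} {σ σ' : Store Chan} :
      Eval al ι (t.inst (.dfix t)) σ v σ' → Eval al ι (.adv (.dfix t)) σ v σ'
  | fix {t v : Tm Chan} {σ σ' : Store Chan} :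
      Eval al ι (t.inst (.dfix t)) σ v σ' → Eval al ι (.fix t) σ v σ'
  | unbox {t t' v : Tm Chan} {σ σ' σ'' : Store Chan} :
      Eval al ι t σ (.box t') σ' → Eval al ι t' σ' v σ'' → Eval al ι (.unbox t) σ v σ''
  | into {t v : Tm Chan} {σ σ' : Store Chan} :
      Eval al ι t σ v σ' → Eval al ι (.into t) σ (.into v) σ'
  | out {t v : Tm Chan} {σ σ' : Store Chan} :
      Eval al ι t σ (.into v) σ' → Eval al ι (.out t) σ v σ'

/-! ## The Kripke logical relation -/

/-- The term relation determined by a family `P` of sets of values, indexed by stores. -/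
def liftRel (al : Allocator Chan) (Δ : InputCtx Chan) (P : Store Chan → Set (Tm Chan))
    (σ : Store Chan) : Set (Tm Chan) :=
  {t | t.Closed ∧ ∀ ι, BufferOk Δ ι → ∀ σ', Store.TickLe Δ σ σ' →
    ∃ σ'' v, Eval al ι t σ' v σ'' ∧ v ∈ P σ''}

/-- The value relation `𝒱⟦A⟧(n, σ)`, consisting of closed terms. -/
def valRel (al : Allocator Chan) (Δ : InputCtx Chan) :
    (A : Ty 0) → (n : ℕ) → Store Chan → Set (Tm Chan)
  | .unit, _ => fun _ => {.unit}
  | .nat, _ => fun _ => {u | ∃ m, u = numeral m}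
  | .prod A B, n => fun σ =>
      {u | ∃ v w, u = .pair v w ∧ v ∈ valRel al Δ A n σ ∧ w ∈ valRel al Δ B n σ}
  | .sum A B, n => fun σ =>
      {u | (∃ v, u = .inl v ∧ v ∈ valRel al Δ A n σ) ∨ (∃ v, u = .inr v ∧ v ∈ valRel al Δ B n σ)}
  | .arrow A B, n => fun σ =>
      {u | u.Closed ∧ ∃ t, u = .lam t ∧
        ∀ σ', Store.TickLe Δ (.later σ.gc) σ' → ∀ n', n' ≤ n → ∀ v ∈ valRel al Δ A n' σ',
          t.inst v ∈ liftRel al Δ (valRel al Δ B n') σ'}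
  | .box A, n => fun _ =>
      {u | ∃ t, u = .box t ∧ t ∈ liftRel al Δ (valRel al Δ A n) .empty}
  | .delayA _, 0 => fun _ => {u | u.Closed ∧ ∃ t, u = .dfix t}
  | .delayA A, n + 1 => fun _ =>
      {u | u.Closed ∧ ∃ t, u = .dfix t ∧
        t.inst (.dfix t) ∈ liftRel al Δ (valRel al Δ A n) .empty}
  | .delayE A, 0 => fun _ =>
      {u | (∃ l, u = .loc l ∧ ↑l.clock ⊆ Δ.pushDom) ∨
        (∃ κ c, u = .inp κ ∧ Δ.decl κ = some (c, A) ∧ c.isPush)}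
  | .delayE A, n + 1 => fun σ =>
      {u | (∃ l, u = .loc l ∧ ↑l.clock ⊆ Δ.pushDom ∧
          ∀ κ ∈ l.clock, ∀ v, InputOk Δ κ v → ∃ t, σ.gc.get l = some t ∧
            t ∈ liftRel al Δ (valRel al Δ A n) ((Store.receive σ.gc κ v).restr l.clock)) ∨
        (∃ κ c, u = .inp κ ∧ Δ.decl κ = some (c, A) ∧ c.isPush)}
  | .fix A, n => fun σ => {u | ∃ v, u = .into v ∧ v ∈ valRel al Δ A.unfold n σ}
termination_by A n => (n, A.size)
decreasing_by
  all_goals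
    simp only [Prod.lex_def, Ty.size, Ty.size_unfold, true_and]
    omega

/-- The term relation `𝒯⟦A⟧(n, σ)`. -/
def termRel (al : Allocator Chan) (Δ : InputCtx Chan) (A : Ty 0) (n : ℕ) (σ : Store Chan) :
    Set (Tm Chan) :=
  liftRel al Δ (valRel al Δ A n) σ

/-- The context relation `𝒞⟦Γ⟧(n, σ)`. Environments assign terms to variable indices; only the
entries for the variables of `Γ` are relevant. -/
def ctxRel (al : Allocator Chan) (Δ : InputCtx Chan) :
    Ctx Chan → ℕ → Store Chan → Set (ℕ → Tm Chan)
  | [], _, _ => Set.univ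
  | .var A :: Γ, n, σ =>
      {γ | ∃ γ' v, γ = scons v γ' ∧ γ' ∈ ctxRel al Δ Γ n σ ∧ v ∈ valRel al Δ A n σ}
  | .tick _ :: _, _, .later _ => ∅
  | .tick θ :: Γ, n, .ticked ηN κ v ηL _ =>
      {γ | ∃ (Θ : Finset Chan) (ηN' ηL' : Heap Chan), (θ.subst γ).eval = some Θ ∧
        γ ∈ ctxRel al Δ Γ (n + 1) (.later (ηN'.union (ηL'.withoutChan κ))) ∧
        ηL.restr Θ = ηL'.restr Θ ∧ ηN.restr Θ = ηN'.restr Θ ∧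
        ηN'.OnChan κ ∧ InputOk Δ κ v ∧ κ ∈ Θ ∧ ↑Θ ⊆ Δ.pushDom}

end Semantics

end AsyncRaTT

/-!
The proof is by induction on the typing derivation, with one compatibility lemma (`semTyped_*`)
for each typing rule, and rests on the Kripke structure of the relation. Values are preserved when
the step index decreases and when the later heap grows (`valRel_mono`), which is all that
evaluation does to it (`Eval.le`); values of stable type do not depend on the store at all
(`valRel_of_isStable`), so they survive ticks, and `fix` and `box` may use them.

A delayed computation `delay θ t` is stored on the clock denoted by `θ`. When an input arrives on
a channel of that clock, the location moves from the later heap to the now heap, and the resulting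
store is one for the context extended by the tick (`mem_ctxRel_tick_receive`). Conversely, the
context relation for a tick provides a heap from before the tick, at the successor of the step
index, whose entries on the clock of the tick are split between the two heaps of the current
store (`exists_beforeTick`). A delayed value over that heap can therefore be advanced if its clock
has ticked (`adv_mem_termRel`), and otherwise is a delayed value in the current store
(`mem_valRel_delayE_of_not_mem`); `select` combines the two. For `fix`, an inner induction on the
step index shows that `dfix x.t` is a value of type `◯∀A`, because the relation at index `m + 1`
asks for the unfolding at index `m` only.

The induction cannot be confined to well-formed contexts: the rules without a side condition on
the context let the body of a `delay` be typed under two ticks. Such a body can use variables only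
after stabilisation, in the scope of `box` or `fix`. `EnvRel` therefore asks for the context
relation if the context is well-formed, and in any case for its part that survives all ticks,
`StableEnv`.
-/

namespace AsyncRaTT

/-! ### Substitution -/

section Substitution

variable {Chan : Type u}

theorem upSub_comp_upRen (s : ℕ → Tm Chan) (ρ : ℕ → ℕ) :
    (fun i => upSub s (upRen ρ i)) = upSub (fun i => s (ρ i)) := by
  funext i; cases i <;> rfl

theorem upSub_var : upSub (Tm.var (Chan := Chan)) = Tm.var := by
  funext i; cases i <;> rfl

theorem upRen_comp (ρ ρ' : ℕ → ℕ) :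
    (fun i => upRen ρ' (upRen ρ i)) = upRen (fun i => ρ' (ρ i)) := by
  funext i; cases i <;> rfl

namespace Tm

theorem rename_subst (t : Tm Chan) :
    ∀ (ρ : ℕ → ℕ) (s : ℕ → Tm Chan), (t.rename ρ).subst s = t.subst (fun i => s (ρ i)) := by
  apply Tm.rec
    (motive_1 := fun t => ∀ (ρ : ℕ → ℕ) (s : ℕ → Tm Chan),
      (t.rename ρ).subst s = t.subst (fun i => s (ρ i)))
    (motive_2 := fun θ => ∀ (ρ : ℕ → ℕ) (s : ℕ → Tm Chan),
      (θ.rename ρ).subst s = θ.subst (fun i => s (ρ i)))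
  all_goals intros
  all_goals simp only [rename, subst, Clk.rename, Clk.subst, upSub_comp_upRen, *]

theorem rename_rename (t : Tm Chan) :
    ∀ (ρ ρ' : ℕ → ℕ), (t.rename ρ).rename ρ' = t.rename (fun i => ρ' (ρ i)) := by
  apply Tm.rec
    (motive_1 := fun t => ∀ (ρ ρ' : ℕ → ℕ),
      (t.rename ρ).rename ρ' = t.rename (fun i => ρ' (ρ i)))
    (motive_2 := fun θ => ∀ (ρ ρ' : ℕ → ℕ),
      (θ.rename ρ).rename ρ' = θ.rename (fun i => ρ' (ρ i)))
  all_goals intros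
  all_goals simp only [rename, Clk.rename, upRen_comp, *]

theorem subst_var (t : Tm Chan) : t.subst var = t := by
  apply Tm.rec
    (motive_1 := fun t => t.subst var = t)
    (motive_2 := fun θ => θ.subst var = θ)
  all_goals intros
  all_goals simp only [subst, Clk.subst, upSub_var, *]

end Tm

theorem rename_upSub (s : ℕ → Tm Chan) (ρ : ℕ → ℕ) :
    (fun i => (upSub s i).rename (upRen ρ)) = upSub (fun i => (s i).rename ρ) := by
  funext i
  cases i with
  | zero => rfl
  | succ i => simp only [upSub, scons, Tm.rename_rename]; rfl

namespace Tm

theorem subst_rename (t : Tm Chan) :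
    ∀ (s : ℕ → Tm Chan) (ρ : ℕ → ℕ), (t.subst s).rename ρ = t.subst (fun i => (s i).rename ρ) := by
  apply Tm.rec
    (motive_1 := fun t => ∀ (s : ℕ → Tm Chan) (ρ : ℕ → ℕ),
      (t.subst s).rename ρ = t.subst (fun i => (s i).rename ρ))
    (motive_2 := fun θ => ∀ (s : ℕ → Tm Chan) (ρ : ℕ → ℕ),
      (θ.subst s).rename ρ = θ.subst (fun i => (s i).rename ρ))
  all_goals intros
  all_goals simp only [rename, subst, Clk.rename, Clk.subst, rename_upSub, *]

end Tm

theorem subst_upSub (s s' : ℕ → Tm Chan) :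
    (fun i => (upSub s i).subst (upSub s')) = upSub (fun i => (s i).subst s') := by
  funext i
  cases i with
  | zero => rfl
  | succ i => simp only [upSub, scons, Tm.rename_subst, Tm.subst_rename]

namespace Tm

theorem subst_subst (t : Tm Chan) :
    ∀ (s s' : ℕ → Tm Chan), (t.subst s).subst s' = t.subst (fun i => (s i).subst s') := by
  apply Tm.rec
    (motive_1 := fun t => ∀ (s s' : ℕ → Tm Chan),
      (t.subst s).subst s' = t.subst (fun i => (s i).subst s'))
    (motive_2 := fun θ => ∀ (s s' : ℕ → Tm Chan),
      (θ.subst s).subst s' = θ.subst (fun i => (s i).subst s'))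
  all_goals intros
  all_goals simp only [subst, Clk.subst, subst_upSub, *]

theorem inst_subst_upSub (t v : Tm Chan) (γ : ℕ → Tm Chan) :
    (t.subst (upSub γ)).inst v = t.subst (scons v γ) := by
  rw [inst, subst_subst]
  congr 1
  funext i
  cases i with
  | zero => rfl
  | succ i => simp only [upSub, scons, rename_subst, subst_var]

theorem inst₂_subst_upSub (t v w : Tm Chan) (γ : ℕ → Tm Chan) :
    (t.subst (upSub (upSub γ))).inst₂ v w = t.subst (scons w (scons v γ)) := by
  rw [inst₂, subst_subst]
  congr 1
  funext i
  rcases i with _ | _ | i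
  · rfl
  · rfl
  · simp only [upSub, scons, rename_subst, subst_var]

end Tm

theorem upRen_lt {ρ : ℕ → ℕ} {k m : ℕ} (h : ∀ i < k, ρ i < m) :
    ∀ i < k + 1, upRen ρ i < m + 1 := by
  rintro (_ | i) hi
  · exact Nat.succ_pos _
  · exact Nat.succ_lt_succ (h i (Nat.lt_of_succ_lt_succ hi))

namespace Tm

theorem FreeBelow.rename {t : Tm Chan} : ∀ {k m : ℕ} {ρ : ℕ → ℕ}, t.FreeBelow k →
    (∀ i < k, ρ i < m) → (t.rename ρ).FreeBelow m := by
  apply Tm.rec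
    (motive_1 := fun t => ∀ {k m : ℕ} {ρ : ℕ → ℕ}, t.FreeBelow k →
      (∀ i < k, ρ i < m) → (t.rename ρ).FreeBelow m)
    (motive_2 := fun θ => ∀ {k m : ℕ} {ρ : ℕ → ℕ}, θ.FreeBelow k →
      (∀ i < k, ρ i < m) → (θ.rename ρ).FreeBelow m)
  all_goals intros
  all_goals simp only [Tm.rename, Clk.rename, FreeBelow, Clk.FreeBelow] at *
  all_goals grind [upRen_lt]

end Tm

theorem freeBelow_upSub {s : ℕ → Tm Chan} {k m : ℕ} (h : ∀ i < k, (s i).FreeBelow m) :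
    ∀ i < k + 1, (upSub s i).FreeBelow (m + 1) := by
  rintro (_ | i) hi
  · simp [upSub, scons, Tm.FreeBelow]
  · exact (h i (Nat.lt_of_succ_lt_succ hi)).rename fun j hj => Nat.succ_lt_succ hj

namespace Tm

theorem FreeBelow.subst {t : Tm Chan} : ∀ {k m : ℕ} {s : ℕ → Tm Chan}, t.FreeBelow k →
    (∀ i < k, (s i).FreeBelow m) → (t.subst s).FreeBelow m := by
  apply Tm.rec
    (motive_1 := fun t => ∀ {k m : ℕ} {s : ℕ → Tm Chan}, t.FreeBelow k →
      (∀ i < k, (s i).FreeBelow m) → (t.subst s).FreeBelow m)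
    (motive_2 := fun θ => ∀ {k m : ℕ} {s : ℕ → Tm Chan}, θ.FreeBelow k →
      (∀ i < k, (s i).FreeBelow m) → (θ.subst s).FreeBelow m)
  all_goals intros
  all_goals simp only [Tm.subst, Clk.subst, FreeBelow, Clk.FreeBelow] at *
  all_goals grind [freeBelow_upSub]

end Tm

end Substitution

/-! ### Typing -/

section Typing

variable {Chan : Type u} {Δ : InputCtx Chan}

theorem numVars_append (Γ' Γ : Ctx Chan) : numVars (Γ' ++ Γ) = numVars Γ' + numVars Γ := by
  induction Γ' with
  | nil => simp [numVars]
  | cons e Γ' ih =>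
    cases e
    all_goals simp only [List.cons_append, numVars, ih]
    omega

theorem TickFree.wfCtx {Γ : Ctx Chan} (h : TickFree Γ) : WfCtx Δ Γ := by
  induction Γ with
  | nil => exact .nil
  | cons e Γ ih =>
    cases e with
    | var A => exact .var (ih h)
    | tick θ => exact h.elim

theorem WfCtx.of_var {Γ : Ctx Chan} {A : Ty 0} (h : WfCtx Δ (.var A :: Γ)) : WfCtx Δ Γ := by
  cases h; assumption

theorem WfCtx.of_tick {Γ : Ctx Chan} {θ : Clk Chan} (h : WfCtx Δ (.tick θ :: Γ)) :
    TickFree Γ := by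
  cases h; assumption

/-- A well-formed context contains at most one tick. -/
theorem WfCtx.tickFree_of_append_tick {Γ' Γ : Ctx Chan} {θ : Clk Chan}
    (h : WfCtx Δ (Γ' ++ .tick θ :: Γ)) : TickFree Γ' ∧ TickFree Γ := by
  induction Γ' with
  | nil => exact ⟨trivial, h.of_tick⟩
  | cons e Γ' ih =>
    cases e with
    | var A => exact ih h.of_var
    | tick θ' =>
      exfalso
      have h' : TickFree (Γ' ++ .tick θ :: Γ) := WfCtx.of_tick h
      clear h ih
      induction Γ' with
      | nil => exact h'
      | cons e Γ' ih =>
        cases e with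
        | var A => exact ih h'
        | tick θ' => exact h'

theorem stabEmb_lt (Γ : Ctx Chan) : ∀ i < numVars (stabilize Γ), stabEmb Γ i < numVars Γ := by
  induction Γ with
  | nil => exact fun i hi => hi
  | cons e Γ ih =>
    cases e with
    | var A =>
      by_cases h : A.isStable = true
      · simpa [stabilize, stabEmb, numVars, h] using upRen_lt ih
      · simpa [stabilize, stabEmb, numVars, h] using ih
    | tick θ => exact ih

/-- Typed terms contain no other free variables than those of the context. -/
theorem HasType.freeBelow {Γ : Ctx Chan} {t : Tm Chan} {A : Ty 0} (h : HasType Δ Γ t A) :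
    t.FreeBelow (numVars Γ) := by
  apply HasType.rec (Δ := Δ)
    (motive_1 := fun _ _ => True)
    (motive_2 := fun Γ θ _ => θ.FreeBelow (numVars Γ))
    (motive_3 := fun Γ t _ _ => t.FreeBelow (numVars Γ)) (t := h)
  all_goals intros
  all_goals simp only [Tm.FreeBelow, Clk.FreeBelow, numVars_append, numVars] at *
  case adv ih _ => exact ih.rename fun i hi => by omega
  case select ih₁ ih₂ _ =>
    exact ⟨ih₁.rename fun i hi => by omega, ih₂.rename fun i hi => by omega⟩
  case fix ih => exact ih.rename (upRen_lt (stabEmb_lt _))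
  case box ih => exact ih.rename (stabEmb_lt _)
  all_goals first | trivial | omega

end Typing

/-! ### Heaps and stores -/

section Stores

variable {Chan : Type u} {Δ : InputCtx Chan}

namespace Heap

theorem le_iff {η η' : Heap Chan} :
    η.le η' ↔ ∀ l t, η.get l = some t → η'.get l = some t := by
  constructor
  · intro h l t hl
    rw [← h l (by simp [dom, hl]), hl]
  · intro h l hl
    obtain ⟨t, ht⟩ := Option.ne_none_iff_exists'.1 hl
    rw [ht, h l t ht]

theorem le_refl (η : Heap Chan) : η.le η := fun _ _ => rfl

theorem le_trans {η₁ η₂ η₃ : Heap Chan} (h : η₁.le η₂) (h' : η₂.le η₃) : η₁.le η₃ := by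
  rw [le_iff] at *
  exact fun l t hl => h' l t (h l t hl)

theorem empty_le (η : Heap Chan) : Heap.empty.le η := fun _ hl => (hl rfl).elim

theorem le_insert {η : Heap Chan} {l : Loc Chan} (hl : l ∉ η.dom) (t : Tm Chan) :
    η.le (η.insert l t) := by
  intro l' hl'
  have : l' ≠ l := fun h => hl (h ▸ hl')
  simp [insert, this]

theorem get_insert_self (η : Heap Chan) (l : Loc Chan) (t : Tm Chan) :
    (η.insert l t).get l = some t := by simp [insert]

theorem get_filter_eq_some {P : Loc Chan → Prop} {η : Heap Chan} {l : Loc Chan} {t : Tm Chan} :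
    (η.filter P).get l = some t ↔ P l ∧ η.get l = some t := by
  by_cases h : P l <;> simp [filter, h]

theorem get_union_eq_some {η η' : Heap Chan} {l : Loc Chan} {t : Tm Chan} :
    (η.union η').get l = some t ↔
      η.get l = some t ∨ η.get l = none ∧ η'.get l = some t := by
  simp [union, Option.or_eq_some_iff]

theorem OnChan.get_eq_none {κ : Chan} {η : Heap Chan} (h : η.OnChan κ) {l : Loc Chan}
    (hl : κ ∉ l.clock) : η.get l = none := by
  by_contra hne
  exact hl (h l hne)

theorem get_eq_of_restr_eq {Θ : Finset Chan} {η η' : Heap Chan} (h : η.restr Θ = η'.restr Θ)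
    {l : Loc Chan} (hl : l.clock ⊆ Θ) : η.get l = η'.get l := by
  have := congrArg (fun η : Heap Chan => η.get l) h
  simpa [restr, filter, hl] using this

theorem ext_some {η η' : Heap Chan} (h : ∀ l t, η.get l = some t ↔ η'.get l = some t) :
    η = η' := by
  ext l t
  exact h l t

end Heap

namespace Store

theorem Le.refl (σ : Store Chan) : Le σ σ := by
  cases σ with
  | later => exact .later (Heap.le_refl _)
  | ticked => exact .ticked (Heap.le_refl _) (Heap.le_refl _)

theorem Le.trans {σ₁ σ₂ σ₃ : Store Chan} (h : Le σ₁ σ₂) (h' : Le σ₂ σ₃) : Le σ₁ σ₃ := by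
  cases h with
  | later h₁ => cases h' with | later h₂ => exact .later (Heap.le_trans h₁ h₂)
  | ticked h₁ k₁ =>
    cases h' with
    | ticked h₂ k₂ => exact .ticked (Heap.le_trans h₁ h₂) (Heap.le_trans k₁ k₂)

theorem Le.gc_le {σ σ' : Store Chan} (h : Le σ σ') : σ.gc.le σ'.gc := by
  cases h <;> assumption

theorem TickLe.refl (σ : Store Chan) : TickLe Δ σ σ := .le (.refl σ)

theorem TickLe.trans {σ₁ σ₂ σ₃ : Store Chan} (h : TickLe Δ σ₁ σ₂) (h' : TickLe Δ σ₂ σ₃) :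
    TickLe Δ σ₁ σ₃ := by
  cases h with
  | le h =>
    cases h' with
    | le h' => exact .le (h.trans h')
    | input k hv => cases h with | later h => exact .input (Heap.le_trans h k) hv
  | input k hv =>
    cases h' with
    | le h' => cases h' with | ticked _ k' => exact .input (Heap.le_trans k k') hv

theorem TickLe.gc_le {σ σ' : Store Chan} (h : TickLe Δ σ σ') : σ.gc.le σ'.gc := by
  cases h with
  | le h => exact h.gc_le
  | input h => exact h

theorem TickLe.inputTyped {σ σ' : Store Chan} (h : TickLe Δ σ σ') (hσ : σ.InputTyped Δ) :
    σ'.InputTyped Δ := by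
  cases h with
  | le h =>
    cases h with
    | later => trivial
    | ticked => exact hσ
  | input _ hv => exact hv

/-- A heap lies below every store with well-typed input whose later heap extends it. -/
theorem later_tickLe {η : Heap Chan} {σ : Store Chan} (hσ : σ.InputTyped Δ) (h : η.le σ.gc) :
    TickLe Δ (.later η) σ := by
  cases σ with
  | later => exact .le (.later h)
  | ticked => exact .input h hσ

theorem empty_tickLe {σ : Store Chan} (hσ : σ.InputTyped Δ) : TickLe Δ .empty σ :=
  later_tickLe hσ (Heap.empty_le _)

theorem le_insert {σ : Store Chan} {l : Loc Chan} (hl : l ∉ σ.gc.dom) (t : Tm Chan) :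
    Le σ (σ.insert l t) := by
  cases σ with
  | later => exact .later (Heap.le_insert hl t)
  | ticked => exact .ticked (Heap.le_refl _) (Heap.le_insert hl t)

theorem gc_insert (σ : Store Chan) (l : Loc Chan) (t : Tm Chan) :
    (σ.insert l t).gc = σ.gc.insert l t := by
  cases σ <;> rfl

theorem receive_restr {η : Heap Chan} {κ : Chan} {v : Tm Chan} {Θ : Finset Chan} (hκ : κ ∈ Θ) :
    (receive η κ v).restr Θ =
      .ticked ((η.withChan κ).restr Θ) κ v ((η.withoutChan κ).restr Θ)
        ((Heap.onChan_withChan κ η).restr Θ) := by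
  simp [receive, restr, hκ]

theorem receive_restr_mono {η η' : Heap Chan} {κ : Chan} {v : Tm Chan} {Θ : Finset Chan}
    (hκ : κ ∈ Θ) (h : ∀ l t, l.clock ⊆ Θ → η.get l = some t → η'.get l = some t) :
    Le ((receive η κ v).restr Θ) ((receive η' κ v).restr Θ) := by
  rw [receive_restr hκ, receive_restr hκ]
  refine .ticked ?_ ?_ <;>
  · rw [Heap.le_iff]
    intro l t
    simp only [Heap.restr, Heap.withChan, Heap.withoutChan, Heap.get_filter_eq_some]
    exact fun ⟨hl, hP, hg⟩ => ⟨hl, hP, h l t hl hg⟩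

end Store

/-- Evaluation only allocates. -/
theorem Eval.le {al : Allocator Chan} {ι : Buffer Chan} {t v : Tm Chan} {σ σ' : Store Chan}
    (h : Eval al ι t σ v σ') : Store.Le σ σ' := by
  induction h with
  | delay => exact Store.le_insert (al.fresh _ _) _
  | value | buf | never | adv_inp => exact .refl _
  | app _ _ _ ih₁ ih₂ ih₃ | natrec_suc _ _ _ ih₁ ih₂ ih₃ => exact ih₁.trans (ih₂.trans ih₃)
  | pair _ _ ih₁ ih₂ | case_inl _ _ ih₁ ih₂ | case_inr _ _ ih₁ ih₂ | letIn _ _ ih₁ ih₂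
  | natrec_zero _ _ ih₁ ih₂ | unbox _ _ ih₁ ih₂ => exact ih₁.trans ih₂
  | select_both _ _ _ _ _ _ ih₁ ih₂ => exact ih₁.trans ih₂
  | _ => assumption

end Stores

/-! ### The value relation -/

section ValRel

variable {Chan : Type u} {al : Allocator Chan} {Δ : InputCtx Chan}

theorem liftRel_mono {P Q : Store Chan → Set (Tm Chan)} (hPQ : ∀ σ, P σ ⊆ Q σ)
    {σ σ' : Store Chan} (h : Store.TickLe Δ σ σ') :
    liftRel al Δ P σ ⊆ liftRel al Δ Q σ' := by
  rintro t ⟨hc, ht⟩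
  refine ⟨hc, fun ι hι τ hτ => ?_⟩
  obtain ⟨τ', v, he, hv⟩ := ht ι hι τ (h.trans hτ)
  exact ⟨τ', v, he, hPQ _ hv⟩

/-- The value relation is closed under decreasing the step index and extending the later heap. -/
theorem valRel_mono : (A : Ty 0) → {n m : ℕ} → m ≤ n → {σ σ' : Store Chan} →
    σ.gc.le σ'.gc → valRel al Δ A n σ ⊆ valRel al Δ A m σ'
  | .unit, n, m, hmn, σ, σ', h => by simp only [valRel]; exact subset_rfl
  | .nat, n, m, hmn, σ, σ', h => by simp only [valRel]; exact subset_rfl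
  | .prod A B, n, m, hmn, σ, σ', h => by
    simp only [valRel]
    rintro u ⟨v, w, rfl, hv, hw⟩
    exact ⟨v, w, rfl, valRel_mono A hmn h hv, valRel_mono B hmn h hw⟩
  | .sum A B, n, m, hmn, σ, σ', h => by
    simp only [valRel]
    rintro u (⟨v, rfl, hv⟩ | ⟨v, rfl, hv⟩)
    · exact .inl ⟨v, rfl, valRel_mono A hmn h hv⟩
    · exact .inr ⟨v, rfl, valRel_mono B hmn h hv⟩
  | .arrow A B, n, m, hmn, σ, σ', h => by
    simp only [valRel]
    rintro u ⟨hc, t, rfl, ht⟩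
    refine ⟨hc, t, rfl, fun τ hτ k hk v hv => ?_⟩
    exact ht τ (Store.TickLe.trans (.le (.later h)) hτ) k (hk.trans hmn) v hv
  | .box A, n, m, hmn, σ, σ', h => by
    simp only [valRel]
    rintro u ⟨t, rfl, ht⟩
    exact ⟨t, rfl, liftRel_mono (fun τ => valRel_mono A hmn (Heap.le_refl _)) (.refl _) ht⟩
  | .delayA A, n, 0, hmn, σ, σ', h => by
    cases n with
    | zero => simp only [valRel]; exact subset_rfl
    | succ n =>
      simp only [valRel]
      rintro u ⟨hc, t, rfl, ht⟩
      exact ⟨hc, t, rfl⟩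
  | .delayA A, n + 1, m + 1, hmn, σ, σ', h => by
    simp only [valRel]
    rintro u ⟨hc, t, rfl, ht⟩
    exact ⟨hc, t, rfl, liftRel_mono
      (fun τ => valRel_mono A (Nat.le_of_succ_le_succ hmn) (Heap.le_refl _)) (.refl _) ht⟩
  | .delayE A, n, 0, hmn, σ, σ', h => by
    cases n with
    | zero => simp only [valRel]; exact subset_rfl
    | succ n =>
      simp only [valRel]
      rintro u (⟨l, rfl, hl, -⟩ | hu)
      · exact .inl ⟨l, rfl, hl⟩
      · exact .inr hu
  | .delayE A, n + 1, m + 1, hmn, σ, σ', h => by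
    simp only [valRel]
    rintro u (⟨l, rfl, hl, hu⟩ | hu)
    · refine .inl ⟨l, rfl, hl, fun κ hκ v hv => ?_⟩
      obtain ⟨t, hlt, ht⟩ := hu κ hκ v hv
      rw [Heap.le_iff] at h
      exact ⟨t, h l t hlt, liftRel_mono
        (fun τ => valRel_mono A (Nat.le_of_succ_le_succ hmn) (Heap.le_refl _))
        (.le (Store.receive_restr_mono hκ fun l t _ => h l t)) ht⟩
    · exact .inr hu
  | .fix A, n, m, hmn, σ, σ', h => by
    simp only [valRel]
    rintro u ⟨v, rfl, hv⟩
    exact ⟨v, rfl, valRel_mono A.unfold hmn h hv⟩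
termination_by A n => (n, A.size)
decreasing_by
  all_goals
    simp only [Prod.lex_def, Ty.size, Ty.size_unfold, true_and]
    omega

/-- The value relation consists of closed values. -/
theorem closed_of_mem_valRel : (A : Ty 0) → {n : ℕ} → {σ : Store Chan} → {v : Tm Chan} →
    v ∈ valRel al Δ A n σ → v.Closed ∧ IsValue v
  | .unit, n, σ, v, h => by
    simp only [valRel] at h
    obtain rfl := h
    exact ⟨trivial, .unit⟩
  | .nat, n, σ, v, h => by
    simp only [valRel] at h
    obtain ⟨m, rfl⟩ := h
    induction m with
    | zero => exact ⟨trivial, .zero⟩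
    | succ m ih => exact ⟨ih.1, .suc ih.2⟩
  | .prod A B, n, σ, u, h => by
    simp only [valRel] at h
    obtain ⟨v, w, rfl, hv, hw⟩ := h
    obtain ⟨cv, vv⟩ := closed_of_mem_valRel A hv
    obtain ⟨cw, vw⟩ := closed_of_mem_valRel B hw
    exact ⟨⟨cv, cw⟩, .pair vv vw⟩
  | .sum A B, n, σ, u, h => by
    simp only [valRel] at h
    obtain ⟨v, rfl, hv⟩ | ⟨v, rfl, hv⟩ := h
    · exact ⟨(closed_of_mem_valRel A hv).1, .inl (closed_of_mem_valRel A hv).2⟩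
    · exact ⟨(closed_of_mem_valRel B hv).1, .inr (closed_of_mem_valRel B hv).2⟩
  | .arrow A B, n, σ, u, h => by
    simp only [valRel] at h
    obtain ⟨hc, t, rfl, -⟩ := h
    exact ⟨hc, .lam t⟩
  | .box A, n, σ, u, h => by
    simp only [valRel] at h
    obtain ⟨t, rfl, ht⟩ := h
    exact ⟨ht.1, .box t⟩
  | .delayA A, n, σ, u, h => by
    cases n <;> simp only [valRel] at h
    · obtain ⟨hc, t, rfl⟩ := h
      exact ⟨hc, .dfix t⟩
    · obtain ⟨hc, t, rfl, -⟩ := h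
      exact ⟨hc, .dfix t⟩
  | .delayE A, n, σ, u, h => by
    cases n <;> simp only [valRel] at h
    · obtain ⟨l, rfl, -⟩ | ⟨κ, c, rfl, -⟩ := h
      · exact ⟨trivial, .loc l⟩
      · exact ⟨trivial, .inp κ⟩
    · obtain ⟨l, rfl, -⟩ | ⟨κ, c, rfl, -⟩ := h
      · exact ⟨trivial, .loc l⟩
      · exact ⟨trivial, .inp κ⟩
  | .fix A, n, σ, u, h => by
    simp only [valRel] at h
    obtain ⟨v, rfl, hv⟩ := h
    exact ⟨(closed_of_mem_valRel A.unfold hv).1, .into (closed_of_mem_valRel A.unfold hv).2⟩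
termination_by A n => (n, A.size)
decreasing_by
  all_goals
    simp only [Prod.lex_def, Ty.size, Ty.size_unfold, true_and]
    omega

/-- Values of stable types do not refer to the store. -/
theorem valRel_of_isStable : (A : Ty 0) → A.isStable = true → {n : ℕ} → {σ : Store Chan} →
    (σ' : Store Chan) → valRel al Δ A n σ ⊆ valRel al Δ A n σ'
  | .prod A B, hA, n, σ, σ' => by
    simp only [Ty.isStable, Bool.and_eq_true] at hA
    simp only [valRel]
    rintro u ⟨v, w, rfl, hv, hw⟩
    exact ⟨v, w, rfl, valRel_of_isStable A hA.1 σ' hv, valRel_of_isStable B hA.2 σ' hw⟩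
  | .sum A B, hA, n, σ, σ' => by
    simp only [Ty.isStable, Bool.and_eq_true] at hA
    simp only [valRel]
    rintro u (⟨v, rfl, hv⟩ | ⟨v, rfl, hv⟩)
    · exact .inl ⟨v, rfl, valRel_of_isStable A hA.1 σ' hv⟩
    · exact .inr ⟨v, rfl, valRel_of_isStable B hA.2 σ' hv⟩
  | .unit, _, n, σ, σ' => by simp only [valRel]; exact subset_rfl
  | .nat, _, n, σ, σ' => by simp only [valRel]; exact subset_rfl
  | .box A, _, n, σ, σ' => by simp only [valRel]; exact subset_rfl
  | .delayA A, _, n, σ, σ' => by cases n <;> simp only [valRel] <;> exact subset_rfl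
termination_by A => A.size
decreasing_by
  all_goals
    simp only [Ty.size]
    omega

/-- A closed value of a value type is related to itself, in every world. -/
theorem mem_valRel_of_isValueType {v : Tm Chan} (hv : IsValue v) :
    ∀ {A : Ty 0}, A.isValueType = true → HasType (InputCtx.empty Chan) [] v A →
      ∀ (n : ℕ) (σ : Store Chan), v ∈ valRel al Δ A n σ := by
  have key : ∀ {Γ : Ctx Chan} {v : Tm Chan}, Γ = [] → IsValue v → ∀ {A : Ty 0},
      A.isValueType = true → HasType (InputCtx.empty Chan) Γ v A →
      ∀ (n : ℕ) (σ : Store Chan), v ∈ valRel al Δ A n σ := by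
    intro Γ v hΓ hv
    induction hv with
    | var i =>
      intro A _ h
      have := h.freeBelow
      subst hΓ
      exact (Nat.not_lt_zero _ this).elim
    | unit => intro A _ h n σ; cases h; simp [valRel]
    | zero => intro A _ h n σ; cases h; simp only [valRel]; exact ⟨0, rfl⟩
    | suc _ ih =>
      intro A hA h n σ
      cases h with
      | suc h =>
        have := ih hA h n σ
        simp only [valRel] at this ⊢
        obtain ⟨m, rfl⟩ := this
        exact ⟨m + 1, rfl⟩
    | pair _ _ ih₁ ih₂ =>
      intro A hA h n σ
      cases h with
      | pair h₁ h₂ =>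
        simp only [Ty.isValueType, Bool.and_eq_true] at hA
        simp only [valRel]
        exact ⟨_, _, rfl, ih₁ hA.1 h₁ n σ, ih₂ hA.2 h₂ n σ⟩
    | inl _ ih =>
      intro A hA h n σ
      cases h with
      | inl h =>
        simp only [Ty.isValueType, Bool.and_eq_true] at hA
        simp only [valRel]
        exact .inl ⟨_, rfl, ih hA.1 h n σ⟩
    | inr _ ih =>
      intro A hA h n σ
      cases h with
      | inr h =>
        simp only [Ty.isValueType, Bool.and_eq_true] at hA
        simp only [valRel]
        exact .inr ⟨_, rfl, ih hA.2 h n σ⟩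
    | lam | loc | inp | box | dfix | into =>
      intro A hA h
      cases h <;> simp [Ty.isValueType] at hA
  exact @fun A => key rfl hv

theorem InputOk.mem_valRel {κ : Chan} {v : Tm Chan} {c : ChanKind} {A : Ty 0}
    (hv : InputOk Δ κ v) (hκ : Δ.decl κ = some (c, A)) (n : ℕ) (σ : Store Chan) :
    v ∈ valRel al Δ A n σ := by
  obtain ⟨c', A', hκ', hv, ht⟩ := hv
  obtain ⟨-, rfl⟩ := Prod.mk.inj (Option.some.inj (hκ.symm.trans hκ'))
  exact mem_valRel_of_isValueType hv (Δ.valueType _ _ _ hκ) ht n σ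

theorem mem_termRel_of_mem_valRel {A : Ty 0} {n : ℕ} {σ : Store Chan} {v : Tm Chan}
    (hv : v ∈ valRel al Δ A n σ) : v ∈ termRel al Δ A n σ :=
  ⟨(closed_of_mem_valRel A hv).1, fun _ _ τ hτ =>
    ⟨τ, v, .value (closed_of_mem_valRel A hv).2, valRel_mono A le_rfl hτ.gc_le hv⟩⟩

theorem termRel_mono {A : Ty 0} {n m : ℕ} (hmn : m ≤ n) {σ σ' : Store Chan}
    (h : Store.TickLe Δ σ σ') : termRel al Δ A n σ ⊆ termRel al Δ A m σ' :=
  liftRel_mono (fun _ => valRel_mono A hmn (Heap.le_refl _)) h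

end ValRel

/-! ### The context relation -/

section CtxRel

variable {Chan : Type u} {al : Allocator Chan} {Δ : InputCtx Chan}

theorem mem_ctxRel_var {Γ : Ctx Chan} {A : Ty 0} {n : ℕ} {σ : Store Chan} {γ : ℕ → Tm Chan} :
    γ ∈ ctxRel al Δ (.var A :: Γ) n σ ↔
      (fun i => γ (i + 1)) ∈ ctxRel al Δ Γ n σ ∧ γ 0 ∈ valRel al Δ A n σ := by
  constructor
  · rintro ⟨γ', v, rfl, hγ, hv⟩
    exact ⟨hγ, hv⟩
  · rintro ⟨hγ, hv⟩
    refine ⟨_, _, ?_, hγ, hv⟩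
    funext i
    cases i <;> rfl

theorem ctxRel_mono_of_tickFree {Γ : Ctx Chan} (hΓ : TickFree Γ) {n m : ℕ} (hmn : m ≤ n)
    {σ σ' : Store Chan} (h : σ.gc.le σ'.gc) {γ : ℕ → Tm Chan} (hγ : γ ∈ ctxRel al Δ Γ n σ) :
    γ ∈ ctxRel al Δ Γ m σ' := by
  induction Γ generalizing γ with
  | nil => trivial
  | cons e Γ ih =>
    cases e with
    | var A =>
      rw [mem_ctxRel_var] at hγ ⊢
      exact ⟨ih hΓ hγ.1, valRel_mono A hmn h hγ.2⟩
    | tick θ => exact hΓ.elim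

theorem ctxRel_drop {Γ' Γ : Ctx Chan} (hΓ' : TickFree Γ') {n : ℕ} {σ : Store Chan}
    {γ : ℕ → Tm Chan} (hγ : γ ∈ ctxRel al Δ (Γ' ++ Γ) n σ) :
    (fun i => γ (i + numVars Γ')) ∈ ctxRel al Δ Γ n σ := by
  induction Γ' generalizing γ with
  | nil => exact hγ
  | cons e Γ' ih =>
    cases e with
    | var A => exact ih hΓ' (mem_ctxRel_var.1 hγ).1
    | tick θ => exact hΓ'.elim

/-- `BeforeTick Θ κ η ηN ηL` says that, as far as locations on subclocks of `Θ` are concerned,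
the entries of `η` are found in the now heap `ηN` or in the later heap `ηL` of a store that
received an input on `κ`, according to whether `κ` belongs to the clock of the location. -/
def BeforeTick (Θ : Finset Chan) (κ : Chan) (η ηN ηL : Heap Chan) : Prop :=
  ∀ l t, l.clock ⊆ Θ → η.get l = some t →
    (κ ∈ l.clock → ηN.get l = some t) ∧ (κ ∉ l.clock → ηL.get l = some t)

theorem exists_beforeTick {Γ : Ctx Chan} {θ : Clk Chan} {n : ℕ} {σ : Store Chan}
    {γ : ℕ → Tm Chan} (hγ : γ ∈ ctxRel al Δ (.tick θ :: Γ) n σ) :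
    ∃ (ηN ηL : Heap Chan) (κ : Chan) (w : Tm Chan) (hN : ηN.OnChan κ) (Θ : Finset Chan)
      (η : Heap Chan), σ = .ticked ηN κ w ηL hN ∧ (θ.subst γ).eval = some Θ ∧
      γ ∈ ctxRel al Δ Γ (n + 1) (.later η) ∧ BeforeTick Θ κ η ηN ηL ∧ InputOk Δ κ w ∧ κ ∈ Θ := by
  cases σ with
  | later η => exact hγ.elim
  | ticked ηN κ w ηL hN =>
    obtain ⟨Θ, ηN', ηL', hΘ, hγ, hL, hN', hκN, hw, hκ, -⟩ := hγ
    refine ⟨ηN, ηL, κ, w, hN, Θ, _, rfl, hΘ, hγ, fun l t hl ht => ⟨fun hκl => ?_, fun hκl => ?_⟩,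
      hw, hκ⟩
    · rw [Heap.get_eq_of_restr_eq hN' hl]
      rw [Heap.get_union_eq_some, Heap.withoutChan, Heap.get_filter_eq_some] at ht
      tauto
    · rw [Heap.get_eq_of_restr_eq hL hl]
      rw [Heap.get_union_eq_some, Heap.withoutChan, Heap.get_filter_eq_some,
        hκN.get_eq_none hκl] at ht
      simpa [hκl] using ht

open Classical in
/-- The context relation is closed under allocation and the arrival of an input. For a context
with a tick only the former can happen, since `σ` has already received its input. -/
theorem ctxRel_tickLe {Γ : Ctx Chan} {n : ℕ} {σ σ' : Store Chan} (h : Store.TickLe Δ σ σ')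
    {γ : ℕ → Tm Chan} (hγ : γ ∈ ctxRel al Δ Γ n σ) : γ ∈ ctxRel al Δ Γ n σ' := by
  induction Γ generalizing n σ σ' γ with
  | nil => trivial
  | cons e Γ ih =>
    cases e with
    | var A =>
      rw [mem_ctxRel_var] at hγ ⊢
      exact ⟨ih h hγ.1, valRel_mono A le_rfl h.gc_le hγ.2⟩
    | tick θ =>
      cases h with
      | input => exact hγ.elim
      | le h =>
      cases h with
      | later => exact hγ.elim
      | @ticked ηN ηN₁ ηL ηL₁ κ w hN hN₁ leN leL =>
        obtain ⟨Θ, ηN', ηL', hΘ, hγ, hL, hN', hκN, hw, hκ, hp⟩ := hγ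
        -- the witnesses follow the new store on subclocks of `Θ` and the old witnesses elsewhere
        let mix (η η' : Heap Chan) : Heap Chan :=
          (η.restr Θ).union (η'.filter fun l => ¬ l.clock ⊆ Θ)
        have mix_get : ∀ η η' l t, (mix η η').get l = some t ↔
            (l.clock ⊆ Θ ∧ η.get l = some t) ∨ (¬ l.clock ⊆ Θ ∧ η'.get l = some t) := by
          intro η η' l t
          by_cases hl : l.clock ⊆ Θ <;>
            simp [mix, Heap.union, Heap.restr, Heap.filter, hl]
        have restr_mix : ∀ η η', η.restr Θ = (mix η η').restr Θ := by
          intro η η'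
          refine Heap.ext_some fun l t => ?_
          rw [Heap.restr, Heap.restr, Heap.get_filter_eq_some, Heap.get_filter_eq_some, mix_get]
          tauto
        have le_mix : ∀ {η η₁ η' : Heap Chan}, η.le η₁ → η.restr Θ = η'.restr Θ →
            η'.le (mix η₁ η') := by
          intro η η₁ η' hle heq
          rw [Heap.le_iff] at hle ⊢
          intro l t hl
          rw [mix_get]
          by_cases hlΘ : l.clock ⊆ Θ
          · exact .inl ⟨hlΘ, hle l t (by rw [Heap.get_eq_of_restr_eq heq hlΘ, hl])⟩
          · exact .inr ⟨hlΘ, hl⟩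
        have hκ₁ : (mix ηN₁ ηN').OnChan κ := by
          intro l hl
          obtain ⟨t, ht⟩ := Option.ne_none_iff_exists'.1 hl
          obtain ⟨-, ht⟩ | ⟨-, ht⟩ := (mix_get _ _ _ _).1 ht
          · exact hN₁ l (by simp [Heap.dom, ht])
          · exact hκN l (by simp [Heap.dom, ht])
        refine ⟨Θ, mix ηN₁ ηN', mix ηL₁ ηL', hΘ, ih (.le (.later ?_)) hγ, restr_mix _ _,
          restr_mix _ _, hκ₁, hw, hκ, hp⟩
        have leN' := le_mix leN hN'
        have leL' := le_mix leL hL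
        rw [Heap.le_iff] at leN' leL' ⊢
        intro l t
        simp only [Heap.get_union_eq_some, Heap.withoutChan, Heap.get_filter_eq_some]
        rintro (ht | ⟨-, hκl, ht⟩)
        · exact .inl (leN' l t ht)
        · exact .inr ⟨hκ₁.get_eq_none hκl, hκl, leL' l t ht⟩

/-- Receiving an input on a channel of the clock denoted by `θ` leads to a store for the context
extended by `✓θ`. -/
theorem mem_ctxRel_tick_receive {Γ : Ctx Chan} {θ : Clk Chan} {Θ : Finset Chan} {n : ℕ}
    {η : Heap Chan} {κ : Chan} {w : Tm Chan} {γ : ℕ → Tm Chan}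
    (hγ : γ ∈ ctxRel al Δ Γ (n + 1) (.later η)) (hΘ : (θ.subst γ).eval = some Θ)
    (hp : ↑Θ ⊆ Δ.pushDom) (hκ : κ ∈ Θ) (hw : InputOk Δ κ w) :
    γ ∈ ctxRel al Δ (.tick θ :: Γ) n ((Store.receive η κ w).restr Θ) := by
  have restr_restr : ∀ η : Heap Chan, (η.restr Θ).restr Θ = η.restr Θ := by
    intro η
    refine Heap.ext_some fun l t => ?_
    simp only [Heap.restr, Heap.get_filter_eq_some]
    tauto
  have hη : (η.withChan κ).union ((η.withoutChan κ).withoutChan κ) = η := by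
    refine Heap.ext_some fun l t => ?_
    by_cases hl : κ ∈ l.clock <;>
      simp [Heap.union, Heap.withChan, Heap.withoutChan, Heap.filter, hl]
  rw [Store.receive_restr hκ]
  refine ⟨Θ, η.withChan κ, η.withoutChan κ, hΘ, ?_, restr_restr _, restr_restr _,
    Heap.onChan_withChan κ η, hw, hκ, hp⟩
  rwa [hη]

/-- The part of an environment for `Γ` that survives all ticks: its terms are closed, and those
for variables of stable type are related at step index `n`, independently of any store. -/
def StableEnv (al : Allocator Chan) (Δ : InputCtx Chan) :
    Ctx Chan → ℕ → (ℕ → Tm Chan) → Prop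
  | [], _, _ => True
  | .var A :: Γ, n, γ => (γ 0).Closed ∧ (A.isStable = true → γ 0 ∈ valRel al Δ A n .empty) ∧
      StableEnv al Δ Γ n (fun i => γ (i + 1))
  | .tick _ :: Γ, n, γ => StableEnv al Δ Γ n γ

theorem StableEnv.mono {Γ : Ctx Chan} {n m : ℕ} (hmn : m ≤ n) {γ : ℕ → Tm Chan}
    (h : StableEnv al Δ Γ n γ) : StableEnv al Δ Γ m γ := by
  induction Γ generalizing γ with
  | nil => trivial
  | cons e Γ ih =>
    cases e with
    | var A =>
      exact ⟨h.1, fun hA => valRel_mono A hmn (Heap.le_refl _) (h.2.1 hA), ih h.2.2⟩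
    | tick θ => exact ih (γ := γ) h

theorem StableEnv.of_mem_ctxRel {Γ : Ctx Chan} {n : ℕ} {σ : Store Chan} {γ : ℕ → Tm Chan}
    (h : γ ∈ ctxRel al Δ Γ n σ) : StableEnv al Δ Γ n γ := by
  induction Γ generalizing n σ γ with
  | nil => trivial
  | cons e Γ ih =>
    cases e with
    | var A =>
      rw [mem_ctxRel_var] at h
      exact ⟨(closed_of_mem_valRel A h.2).1, fun hA => valRel_of_isStable A hA _ h.2, ih h.1⟩
    | tick θ =>
      obtain ⟨_, _, _, _, _, _, η, -, -, h, -⟩ := exists_beforeTick h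
      exact (ih h).mono (Nat.le_succ n)

theorem StableEnv.closed {Γ : Ctx Chan} {n : ℕ} {γ : ℕ → Tm Chan}
    (h : StableEnv al Δ Γ n γ) : ∀ i < numVars Γ, (γ i).Closed := by
  induction Γ generalizing γ with
  | nil => exact fun i hi => (Nat.not_lt_zero i hi).elim
  | cons e Γ ih =>
    cases e with
    | var A =>
      rintro (_ | i) hi
      · exact h.1
      · exact ih h.2.2 i (Nat.lt_of_succ_lt_succ hi)
    | tick θ => exact ih (γ := γ) h

theorem StableEnv.lookup {Γ' Γ : Ctx Chan} {A : Ty 0} (hA : A.isStable = true) {n : ℕ}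
    {γ : ℕ → Tm Chan} (h : StableEnv al Δ (Γ' ++ .var A :: Γ) n γ) :
    γ (numVars Γ') ∈ valRel al Δ A n .empty := by
  induction Γ' generalizing γ with
  | nil => exact h.2.1 hA
  | cons e Γ' ih =>
    cases e with
    | var B => exact ih h.2.2
    | tick θ => exact ih (γ := γ) h

theorem StableEnv.mem_ctxRel_stabilize {Γ : Ctx Chan} {n : ℕ} {γ : ℕ → Tm Chan}
    (h : StableEnv al Δ Γ n γ) (σ : Store Chan) :
    (fun i => γ (stabEmb Γ i)) ∈ ctxRel al Δ (stabilize Γ) n σ := by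
  induction Γ generalizing γ with
  | nil => trivial
  | cons e Γ ih =>
    cases e with
    | var A =>
      by_cases hA : A.isStable = true
      · simp only [stabilize, stabEmb, hA, if_true, mem_ctxRel_var]
        exact ⟨ih h.2.2, valRel_of_isStable A hA σ (h.2.1 hA)⟩
      · simpa [stabilize, stabEmb, hA] using ih h.2.2
    | tick θ => exact ih (γ := γ) h

/-- Environments for a context that need not be well-formed. The typing rule for `delay` may put a
second tick on top of a well-formed context; no variable rule applies to the result, and the
terms typed in it depend on the environment only through its stable part. -/
structure EnvRel (al : Allocator Chan) (Δ : InputCtx Chan) (Γ : Ctx Chan) (n : ℕ)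
    (σ : Store Chan) (γ : ℕ → Tm Chan) : Prop where
  mem_ctxRel : WfCtx Δ Γ → γ ∈ ctxRel al Δ Γ n σ
  stableEnv : StableEnv al Δ Γ n γ

theorem EnvRel.of_mem_ctxRel {Γ : Ctx Chan} {n : ℕ} {σ : Store Chan} {γ : ℕ → Tm Chan}
    (h : γ ∈ ctxRel al Δ Γ n σ) : EnvRel al Δ Γ n σ γ :=
  ⟨fun _ => h, .of_mem_ctxRel h⟩

theorem EnvRel.tickLe {Γ : Ctx Chan} {n : ℕ} {σ σ' : Store Chan} {γ : ℕ → Tm Chan}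
    (h : EnvRel al Δ Γ n σ γ) (hσ : Store.TickLe Δ σ σ') : EnvRel al Δ Γ n σ' γ :=
  ⟨fun hΓ => ctxRel_tickLe hσ (h.mem_ctxRel hΓ), h.stableEnv⟩

theorem EnvRel.scons {Γ : Ctx Chan} {A : Ty 0} {n : ℕ} {σ : Store Chan} {γ : ℕ → Tm Chan}
    {v : Tm Chan} (h : EnvRel al Δ Γ n σ γ) (hv : v ∈ valRel al Δ A n σ) :
    EnvRel al Δ (.var A :: Γ) n σ (scons v γ) :=
  ⟨fun hΓ => ⟨γ, v, rfl, h.mem_ctxRel hΓ.of_var, hv⟩, (closed_of_mem_valRel A hv).1,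
    fun hA => valRel_of_isStable A hA _ hv, h.stableEnv⟩

theorem EnvRel.closed_subst {Γ : Ctx Chan} {n : ℕ} {σ : Store Chan} {γ : ℕ → Tm Chan}
    (h : EnvRel al Δ Γ n σ γ) {t : Tm Chan} {A : Ty 0} (ht : HasType Δ Γ t A) :
    (t.subst γ).Closed :=
  ht.freeBelow.subst h.stableEnv.closed

end CtxRel

/-! ### Clocks, `adv` and `select` -/

section Clocks

variable {Chan : Type u} {al : Allocator Chan} {Δ : InputCtx Chan}

open Classical in
theorem Clk.eval_join_eq_some {θ θ' : Clk Chan} {Θ : Finset Chan} :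
    (Clk.join θ θ').eval = some Θ ↔
      ∃ Θ₁ Θ₂, θ.eval = some Θ₁ ∧ θ'.eval = some Θ₂ ∧ Θ₁ ∪ Θ₂ = Θ := by
  simp only [Clk.eval]
  cases θ.eval <;> cases θ'.eval <;> simp

theorem ClkEq.eval_subst {θ θ' : Clk Chan} (h : ClkEq θ θ') (γ : ℕ → Tm Chan) :
    (θ.subst γ).eval = (θ'.subst γ).eval := by
  induction h with
  | refl => rfl
  | symm _ ih => exact ih.symm
  | trans _ _ ih₁ ih₂ => exact ih₁.trans ih₂
  | congr _ _ ih₁ ih₂ => simp only [Clk.subst, Clk.eval, ih₁, ih₂]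
  | assoc θ₁ θ₂ θ₃ =>
    simp only [Clk.subst, Clk.eval]
    cases (θ₁.subst γ).eval <;> cases (θ₂.subst γ).eval <;> cases (θ₃.subst γ).eval <;>
      simp [Finset.union_assoc]
  | comm θ θ' =>
    simp only [Clk.subst, Clk.eval]
    cases (θ.subst γ).eval <;> cases (θ'.subst γ).eval <;> simp [Finset.union_comm]
  | idem θ =>
    simp only [Clk.subst, Clk.eval]
    cases (θ.subst γ).eval <;> simp

theorem exists_eval_cl {A : Ty 0} {n : ℕ} {σ : Store Chan} {u : Tm Chan}
    (hu : u ∈ valRel al Δ (.delayE A) n σ) :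
    ∃ Θ, (Clk.cl u).eval = some Θ ∧ ↑Θ ⊆ Δ.pushDom := by
  have inp : ∀ κ c, Δ.decl κ = some (c, A) → c.isPush →
      ∃ Θ, (Clk.cl (.inp κ)).eval = some Θ ∧ ↑Θ ⊆ Δ.pushDom := fun κ c h hp =>
    ⟨{κ}, by simp [Clk.eval], by simpa [InputCtx.pushDom] using ⟨c, ⟨A, h⟩, hp⟩⟩
  cases n <;> simp only [valRel] at hu
  · obtain ⟨l, rfl, hl⟩ | ⟨κ, c, rfl, h, hp⟩ := hu
    · exact ⟨l.clock, by simp [Clk.eval], hl⟩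
    · exact inp κ c h hp
  · obtain ⟨l, rfl, hl, -⟩ | ⟨κ, c, rfl, h, hp⟩ := hu
    · exact ⟨l.clock, by simp [Clk.eval], hl⟩
    · exact inp κ c h hp

/-- The syntactic values of type `◯∃A` are variables and channels, so their instances are in the
value relation. -/
theorem subst_mem_valRel_delayE {Γ : Ctx Chan} {v : Tm Chan} {A : Ty 0} (hv : IsValue v)
    (ht : HasType Δ Γ v (.delayE A)) {n : ℕ} {σ : Store Chan} {γ : ℕ → Tm Chan}
    (hγ : WfCtx Δ Γ → γ ∈ ctxRel al Δ Γ n σ) : v.subst γ ∈ valRel al Δ (.delayE A) n σ := by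
  generalize hB : Ty.delayE A = B at ht
  cases hv <;> cases ht
  case var.var Γ Γ' hst hΓ =>
    subst hB
    have htf : TickFree Γ' := hst.resolve_right (by simp [Ty.isStable])
    simpa [Tm.subst] using (mem_ctxRel_var.1 (ctxRel_drop htf (hγ hΓ))).2
  case inp.inp κ c A hc hκ =>
    cases hB
    cases n <;> simp only [valRel, Tm.subst] <;> exact .inr ⟨κ, c, rfl, hκ, hc⟩
  all_goals cases hB

theorem IsClock.exists_eval {Γ : Ctx Chan} {θ : Clk Chan} (hθ : IsClock Δ Γ θ) {n : ℕ}
    {σ : Store Chan} {γ : ℕ → Tm Chan} (hγ : WfCtx Δ Γ → γ ∈ ctxRel al Δ Γ n σ) :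
    ∃ Θ, (θ.subst γ).eval = some Θ ∧ ↑Θ ⊆ Δ.pushDom := by
  classical
  revert hγ
  apply IsClock.rec (Δ := Δ)
    (motive_1 := fun _ _ => True)
    (motive_2 := fun Γ θ _ => (WfCtx Δ Γ → γ ∈ ctxRel al Δ Γ n σ) →
      ∃ Θ, (θ.subst γ).eval = some Θ ∧ ↑Θ ⊆ Δ.pushDom)
    (motive_3 := fun _ _ _ _ => True) (t := hθ)
  case join =>
    intro Γ θ θ' _ _ ih ih' hγ
    obtain ⟨Θ, h, hp⟩ := ih hγ
    obtain ⟨Θ', h', hp'⟩ := ih' hγ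
    refine ⟨Θ ∪ Θ', Clk.eval_join_eq_some.2 ⟨Θ, Θ', h, h', rfl⟩, ?_⟩
    rw [Finset.coe_union]
    exact Set.union_subset hp hp'
  case cl => exact fun hv ht _ hγ => exists_eval_cl (subst_mem_valRel_delayE hv ht hγ)
  all_goals intros; exact True.intro

/-- A delayed value can be advanced once a channel of its clock has received an input. -/
theorem adv_mem_termRel {A : Ty 0} {n : ℕ} {Θ Θ' : Finset Chan} {κ : Chan} {w u : Tm Chan}
    {η ηN ηL : Heap Chan} {hN : ηN.OnChan κ} (hη : BeforeTick Θ κ η ηN ηL) (hw : InputOk Δ κ w)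
    (hu : u ∈ valRel al Δ (.delayE A) (n + 1) (.later η)) (hΘ' : (Clk.cl u).eval = some Θ')
    (hsub : Θ' ⊆ Θ) (hκ : κ ∈ Θ') :
    .adv u ∈ termRel al Δ A n (.ticked ηN κ w ηL hN) := by
  refine ⟨(closed_of_mem_valRel _ hu).1, fun ι hι τ hτ => ?_⟩
  simp only [valRel] at hu
  cases hτ with
  | le h =>
  cases h with
  | @ticked _ ηN₁ _ ηL₁ _ _ _ hN₁ leN leL =>
  rw [Heap.le_iff] at leN leL
  obtain ⟨l, rfl, hl, hu⟩ | ⟨κ', c, rfl, hκ', hc⟩ := hu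
  · obtain rfl : l.clock = Θ' := by simpa [Clk.eval] using hΘ'
    obtain ⟨t, hlt, ht⟩ := hu κ hκ w hw
    have hle : Store.Le ((Store.receive η κ w).restr l.clock) (.ticked ηN₁ κ w ηL₁ hN₁) := by
      rw [Store.receive_restr hκ]
      refine .ticked ?_ ?_
      · rw [Heap.le_iff]
        intro l' t'
        simp only [Heap.restr, Heap.withChan, Heap.get_filter_eq_some]
        exact fun ⟨h₁, h₂, h₃⟩ => leN _ _ ((hη l' t' (h₁.trans hsub) h₃).1 h₂)
      · rw [Heap.le_iff]
        intro l' t'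
        simp only [Heap.restr, Heap.withoutChan, Heap.get_filter_eq_some]
        exact fun ⟨h₁, h₂, h₃⟩ => leL _ _ ((hη l' t' (h₁.trans hsub) h₃).2 h₂)
    obtain ⟨τ', v, he, hv⟩ := ht.2 ι hι _ (.le hle)
    exact ⟨τ', v, .adv_loc (leN _ _ ((hη l t hsub hlt).1 hκ)) he, hv⟩
  · obtain rfl : {κ'} = Θ' := by simpa [Clk.eval] using hΘ'
    obtain rfl := Finset.mem_singleton.1 hκ
    exact ⟨_, w, .adv_inp, hw.mem_valRel hκ' n _⟩

/-- A delayed value whose clock has not ticked stays a delayed value in the new store. -/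
theorem mem_valRel_delayE_of_not_mem {A : Ty 0} {n : ℕ} {Θ Θ' : Finset Chan} {κ : Chan}
    {u : Tm Chan} {η ηN ηL : Heap Chan} (hη : BeforeTick Θ κ η ηN ηL)
    (hu : u ∈ valRel al Δ (.delayE A) (n + 1) (.later η)) (hΘ' : (Clk.cl u).eval = some Θ')
    (hsub : Θ' ⊆ Θ) (hκ : κ ∉ Θ') {σ : Store Chan} (hσ : ηL.le σ.gc) :
    u ∈ valRel al Δ (.delayE A) n σ := by
  cases n with
  | zero =>
    simp only [valRel] at hu ⊢
    obtain ⟨l, rfl, hl, hu⟩ | hu := hu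
    · exact .inl ⟨l, rfl, hl⟩
    · exact .inr hu
  | succ n =>
    simp only [valRel] at hu ⊢
    obtain ⟨l, rfl, hl, hu⟩ | hu := hu
    · obtain rfl : l.clock = Θ' := by simpa [Clk.eval] using hΘ'
      rw [Heap.le_iff] at hσ
      have hget : ∀ l' t', l'.clock ⊆ l.clock → η.get l' = some t' → σ.gc.get l' = some t' :=
        fun l' t' hl' ht' => hσ _ _ ((hη l' t' (hl'.trans hsub) ht').2 fun h => hκ (hl' h))
      refine .inl ⟨l, rfl, hl, fun κ₁ hκ₁ w hw => ?_⟩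
      obtain ⟨t, hlt, ht⟩ := hu κ₁ hκ₁ w hw
      exact ⟨t, hget l t subset_rfl hlt,
        termRel_mono (Nat.le_succ n) (.le (Store.receive_restr_mono hκ₁ hget)) ht⟩
    · exact .inr hu

open Classical in
theorem select_mem_termRel {A₁ A₂ : Ty 0} {n : ℕ} {Θ₁ Θ₂ : Finset Chan} {κ : Chan}
    {w u₁ u₂ : Tm Chan} {η ηN ηL : Heap Chan} {hN : ηN.OnChan κ}
    (hη : BeforeTick (Θ₁ ∪ Θ₂) κ η ηN ηL) (hw : InputOk Δ κ w)
    (hu₁ : u₁ ∈ valRel al Δ (.delayE A₁) (n + 1) (.later η))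
    (hu₂ : u₂ ∈ valRel al Δ (.delayE A₂) (n + 1) (.later η))
    (hΘ₁ : (Clk.cl u₁).eval = some Θ₁) (hΘ₂ : (Clk.cl u₂).eval = some Θ₂) (hκ : κ ∈ Θ₁ ∪ Θ₂) :
    .select u₁ u₂ ∈ termRel al Δ
      (.sum (.sum (.prod A₁ (.delayE A₂)) (.prod (.delayE A₁) A₂)) (.prod A₁ A₂)) n
      (.ticked ηN κ w ηL hN) := by
  refine ⟨⟨(closed_of_mem_valRel _ hu₁).1, (closed_of_mem_valRel _ hu₂).1⟩, fun ι hι τ hτ => ?_⟩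
  have hsub₁ : Θ₁ ⊆ Θ₁ ∪ Θ₂ := Finset.subset_union_left
  have hsub₂ : Θ₂ ⊆ Θ₁ ∪ Θ₂ := Finset.subset_union_right
  have adv₁ := fun h => (adv_mem_termRel (hN := hN) hη hw hu₁ hΘ₁ hsub₁ h).2 ι hι
  have adv₂ := fun h => (adv_mem_termRel (hN := hN) hη hw hu₂ hΘ₂ hsub₂ h).2 ι hι
  have hτ' := hτ
  cases hτ' with
  | le h =>
  cases h with
  | ticked leN leL =>
  simp only [valRel]
  by_cases h₁ : κ ∈ Θ₁
  · obtain ⟨τ₁, x₁, he₁, hx₁⟩ := adv₁ h₁ _ hτ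
    by_cases h₂ : κ ∈ Θ₂
    · obtain ⟨τ₂, x₂, he₂, hx₂⟩ := adv₂ h₂ _ (hτ.trans (.le he₁.le))
      exact ⟨τ₂, _, .select_both hΘ₁ hΘ₂ h₁ h₂ he₁ he₂,
        .inr ⟨_, rfl, _, _, rfl, valRel_mono A₁ le_rfl he₂.le.gc_le hx₁, hx₂⟩⟩
    · exact ⟨τ₁, _, .select_left hΘ₁ hΘ₂ h₁ h₂ he₁,
        .inl ⟨_, rfl, .inl ⟨_, rfl, _, _, rfl, hx₁,
          mem_valRel_delayE_of_not_mem hη hu₂ hΘ₂ hsub₂ h₂ (Heap.le_trans leL he₁.le.gc_le)⟩⟩⟩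
  · have h₂ : κ ∈ Θ₂ := (Finset.mem_union.1 hκ).resolve_left h₁
    obtain ⟨τ₂, x₂, he₂, hx₂⟩ := adv₂ h₂ _ hτ
    exact ⟨τ₂, _, .select_right hΘ₁ hΘ₂ h₁ h₂ he₂,
      .inl ⟨_, rfl, .inr ⟨_, rfl, _, _, rfl,
        mem_valRel_delayE_of_not_mem hη hu₁ hΘ₁ hsub₁ h₁ (Heap.le_trans leL he₂.le.gc_le), hx₂⟩⟩⟩

end Clocks

/-! ### Semantic typing and the compatibility lemmas -/

section SemTyped

variable {Chan : Type u} {al : Allocator Chan} {Δ : InputCtx Chan}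

/-- Semantic typing: all instances of `t` by related environments are in the term relation. -/
def SemTyped (al : Allocator Chan) (Δ : InputCtx Chan) (Γ : Ctx Chan) (t : Tm Chan)
    (A : Ty 0) : Prop :=
  ∀ ⦃n : ℕ⦄ ⦃σ : Store Chan⦄ ⦃γ : ℕ → Tm Chan⦄, σ.InputTyped Δ → EnvRel al Δ Γ n σ γ →
    t.subst γ ∈ termRel al Δ A n σ

/-- It suffices to evaluate the instances of `t` in the store `σ` itself: the assumptions on `σ`
are inherited by the stores above it. -/
theorem SemTyped.of_eval {Γ : Ctx Chan} {t : Tm Chan} {A : Ty 0} (hT : HasType Δ Γ t A)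
    (h : ∀ ⦃n σ γ⦄, σ.InputTyped Δ → EnvRel al Δ Γ n σ γ → ∀ ι, BufferOk Δ ι →
      ∃ σ' v, Eval al ι (t.subst γ) σ v σ' ∧ v ∈ valRel al Δ A n σ') :
    SemTyped al Δ Γ t A :=
  fun _ _ _ hσ hγ => ⟨hγ.closed_subst hT, fun ι hι _ hτ =>
    h (hτ.inputTyped hσ) (hγ.tickLe hτ) ι hι⟩

/-- Evaluation of a semantically typed term, with the world in which to continue. -/
theorem SemTyped.exists_eval {Γ : Ctx Chan} {t : Tm Chan} {A : Ty 0} (h : SemTyped al Δ Γ t A)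
    {n : ℕ} {σ : Store Chan} {γ : ℕ → Tm Chan} (hσ : σ.InputTyped Δ) (hγ : EnvRel al Δ Γ n σ γ)
    {ι : Buffer Chan} (hι : BufferOk Δ ι) :
    ∃ σ' v, Eval al ι (t.subst γ) σ v σ' ∧ v ∈ valRel al Δ A n σ' ∧ Store.Le σ σ' ∧
      σ'.InputTyped Δ ∧ EnvRel al Δ Γ n σ' γ := by
  obtain ⟨σ', v, he, hv⟩ := (h hσ hγ).2 ι hι σ (.refl σ)
  exact ⟨σ', v, he, hv, he.le, Store.TickLe.inputTyped (.le he.le) hσ, hγ.tickLe (.le he.le)⟩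

/-- Evaluation of an instance of a semantically typed term with one more variable. -/
theorem SemTyped.exists_eval_inst {Γ : Ctx Chan} {t v : Tm Chan} {A B : Ty 0}
    (h : SemTyped al Δ (.var A :: Γ) t B)
    {n : ℕ} {σ : Store Chan} {γ : ℕ → Tm Chan} (hσ : σ.InputTyped Δ) (hγ : EnvRel al Δ Γ n σ γ)
    (hv : v ∈ valRel al Δ A n σ) {ι : Buffer Chan} (hι : BufferOk Δ ι) :
    ∃ σ' w, Eval al ι ((t.subst (upSub γ)).inst v) σ w σ' ∧ w ∈ valRel al Δ B n σ' := by
  obtain ⟨σ', w, he, hw, -⟩ := h.exists_eval hσ (hγ.scons hv) hι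
  exact ⟨σ', w, by rwa [Tm.inst_subst_upSub], hw⟩

/-- By the typing rule, the variable is not behind a tick, so that the context relation applies,
or has a stable type, so that its value survives the tick. -/
theorem EnvRel.mem_valRel_of_var {Γ : Ctx Chan} {i : ℕ} {A : Ty 0} {n : ℕ} {σ : Store Chan}
    {γ : ℕ → Tm Chan} (hγ : EnvRel al Δ Γ n σ γ) (ht : HasType Δ Γ (.var i) A) :
    γ i ∈ valRel al Δ A n σ := by
  cases ht with
  | var hA hΓ =>
    obtain hΓ' | hA := hA
    · simpa using (mem_ctxRel_var.1 (ctxRel_drop hΓ' (hγ.mem_ctxRel hΓ))).2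
    · exact valRel_of_isStable A hA σ (hγ.stableEnv.lookup hA)

theorem semTyped_var {Γ : Ctx Chan} {i : ℕ} {A : Ty 0} (ht : HasType Δ Γ (.var i) A) :
    SemTyped al Δ Γ (.var i) A := by
  intro n σ γ _ hγ
  exact mem_termRel_of_mem_valRel (hγ.mem_valRel_of_var ht)

theorem semTyped_unit {Γ : Ctx Chan} : SemTyped al Δ Γ .unit .unit := by
  intro n σ γ _ _
  refine mem_termRel_of_mem_valRel ?_
  simp only [valRel]
  rfl

theorem semTyped_zero {Γ : Ctx Chan} : SemTyped al Δ Γ .zero .nat := by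
  intro n σ γ _ _
  refine mem_termRel_of_mem_valRel ?_
  simp only [valRel]
  exact ⟨0, rfl⟩

theorem semTyped_lam {Γ : Ctx Chan} {t : Tm Chan} {A B : Ty 0}
    (hT : HasType Δ Γ (.lam t) (.arrow A B)) (ht : SemTyped al Δ (.var A :: Γ) t B)
    (hΓ : TickFree Γ) : SemTyped al Δ Γ (.lam t) (.arrow A B) := by
  intro n σ γ hσ hγ
  refine mem_termRel_of_mem_valRel ?_
  have hc := hγ.closed_subst hT
  simp only [valRel, Tm.subst] at hc ⊢
  refine ⟨hc, _, rfl, fun τ hτ m hm v hv => ?_⟩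
  rw [Tm.inst_subst_upSub]
  refine ht (hτ.inputTyped trivial) (EnvRel.scons (.of_mem_ctxRel ?_) hv)
  exact ctxRel_mono_of_tickFree hΓ hm (show σ.gc.le τ.gc from hτ.gc_le)
    (hγ.mem_ctxRel hΓ.wfCtx)

theorem semTyped_app {Γ : Ctx Chan} {s t : Tm Chan} {A B : Ty 0}
    (hT : HasType Δ Γ (.app s t) B) (hs : SemTyped al Δ Γ s (.arrow A B))
    (ht : SemTyped al Δ Γ t A) : SemTyped al Δ Γ (.app s t) B := by
  refine .of_eval hT fun n σ γ hσ hγ ι hι => ?_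
  obtain ⟨σ₁, f, he₁, hf, -, hσ₁, hγ₁⟩ := hs.exists_eval hσ hγ hι
  obtain ⟨σ₂, v, he₂, hv, hle, hσ₂, -⟩ := ht.exists_eval hσ₁ hγ₁ hι
  simp only [valRel] at hf
  obtain ⟨-, b, rfl, hb⟩ := hf
  obtain ⟨σ₃, w, he₃, hw⟩ :=
    (hb σ₂ (Store.later_tickLe hσ₂ hle.gc_le) n le_rfl v hv).2 ι hι σ₂ (.refl _)
  exact ⟨σ₃, w, .app he₁ he₂ he₃, hw⟩

theorem semTyped_natrec {Γ : Ctx Chan} {s t r : Tm Chan} {A : Ty 0}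
    (hT : HasType Δ Γ (.natrec s t r) A) (hs : SemTyped al Δ Γ s A)
    (ht : SemTyped al Δ (.var A :: .var .nat :: Γ) t A) (hr : SemTyped al Δ Γ r .nat) :
    SemTyped al Δ Γ (.natrec s t r) A := by
  refine .of_eval hT fun n σ γ hσ hγ ι hι => ?_
  have rec_numeral : ∀ (m : ℕ) (r : Tm Chan) (σ σ₁ : Store Chan),
      Eval al ι r σ (numeral m) σ₁ → σ₁.InputTyped Δ → EnvRel al Δ Γ n σ₁ γ →
      ∃ σ' v, Eval al ι (.natrec (s.subst γ) (t.subst (upSub (upSub γ))) r) σ v σ' ∧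
        v ∈ valRel al Δ A n σ' := by
    intro m
    induction m with
    | zero =>
      intro r σ σ₁ he hσ₁ hγ₁
      obtain ⟨σ₂, v, he', hv, -⟩ := hs.exists_eval hσ₁ hγ₁ hι
      exact ⟨σ₂, v, .natrec_zero he he', hv⟩
    | succ m ih =>
      intro r σ σ₁ he hσ₁ hγ₁
      have hm : ∀ σ, numeral m ∈ valRel al Δ .nat n σ := fun σ => by
        simp only [valRel]; exact ⟨m, rfl⟩
      obtain ⟨σ₂, v, he', hv⟩ :=
        ih (numeral m) σ₁ σ₁ (.value (closed_of_mem_valRel _ (hm σ₁)).2) hσ₁ hγ₁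
      have hσ₂ : σ₂.InputTyped Δ := Store.TickLe.inputTyped (.le he'.le) hσ₁
      obtain ⟨σ₃, w, he'', hw, -⟩ :=
        ht.exists_eval hσ₂ (((hγ₁.tickLe (.le he'.le)).scons (hm σ₂)).scons hv) hι
      rw [← Tm.inst₂_subst_upSub] at he''
      exact ⟨σ₃, w, .natrec_suc he he' he'', hw⟩
  obtain ⟨σ₁, v, he, hv, -, hσ₁, hγ₁⟩ := hr.exists_eval hσ hγ hι
  simp only [valRel] at hv
  obtain ⟨m, rfl⟩ := hv
  exact rec_numeral m _ σ σ₁ he hσ₁ hγ₁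

theorem semTyped_case {Γ : Ctx Chan} {t t₁ t₂ : Tm Chan} {A₁ A₂ B : Ty 0}
    (hT : HasType Δ Γ (.case t t₁ t₂) B) (h₁ : SemTyped al Δ (.var A₁ :: Γ) t₁ B)
    (h₂ : SemTyped al Δ (.var A₂ :: Γ) t₂ B) (ht : SemTyped al Δ Γ t (.sum A₁ A₂)) :
    SemTyped al Δ Γ (.case t t₁ t₂) B := by
  refine .of_eval hT fun n σ γ hσ hγ ι hι => ?_
  obtain ⟨σ₁, v, he, hv, -, hσ₁, hγ₁⟩ := ht.exists_eval hσ hγ hι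
  simp only [valRel] at hv
  obtain ⟨v, rfl, hv⟩ | ⟨v, rfl, hv⟩ := hv
  · obtain ⟨σ₂, w, he', hw⟩ := h₁.exists_eval_inst hσ₁ hγ₁ hv hι
    exact ⟨σ₂, w, .case_inl he he', hw⟩
  · obtain ⟨σ₂, w, he', hw⟩ := h₂.exists_eval_inst hσ₁ hγ₁ hv hι
    exact ⟨σ₂, w, .case_inr he he', hw⟩

theorem semTyped_delay {Γ : Ctx Chan} {θ : Clk Chan} {t : Tm Chan} {A : Ty 0}
    (hT : HasType Δ Γ (.delay θ t) (.delayE A)) (ht : SemTyped al Δ (.tick θ :: Γ) t A)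
    (hθ : IsClock Δ Γ θ) : SemTyped al Δ Γ (.delay θ t) (.delayE A) := by
  refine .of_eval hT fun n σ γ hσ hγ ι hι => ?_
  obtain ⟨Θ, hΘ, hp⟩ := hθ.exists_eval hγ.mem_ctxRel
  refine ⟨_, _, .delay hΘ, ?_⟩
  have hcl := al.clock_alloc Θ σ
  have hfresh := al.fresh Θ σ
  generalize al.alloc Θ σ = l at hcl hfresh
  subst hcl
  cases n with
  | zero =>
    simp only [valRel]
    exact .inl ⟨l, rfl, hp⟩
  | succ n =>
    simp only [valRel, Store.gc_insert]
    refine .inl ⟨l, rfl, hp, fun κ hκ w hw => ⟨_, Heap.get_insert_self _ _ _, ?_⟩⟩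
    refine ht ?_ ⟨fun hΓ => ?_, hγ.stableEnv.mono (Nat.le_succ n)⟩
    · rw [Store.receive_restr hκ]
      exact hw
    · cases hΓ with
      | tick hΓ _ htf =>
        exact mem_ctxRel_tick_receive (ctxRel_mono_of_tickFree htf le_rfl
          (Heap.le_insert hfresh _) (hγ.mem_ctxRel hΓ)) hΘ hp hκ hw

theorem semTyped_never {Γ : Ctx Chan} {A : Ty 0} : SemTyped al Δ Γ .never (.delayE A) := by
  refine .of_eval .never fun n σ γ _ _ ι _ => ⟨_, _, .never, ?_⟩
  have hcl := al.clock_alloc ∅ σ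
  cases n <;> simp only [valRel] <;> exact .inl ⟨_, rfl, by simp [hcl]⟩

theorem semTyped_adv {Γ Γ' : Ctx Chan} {v : Tm Chan} {A : Ty 0} (hv : IsValue v)
    (ht : HasType Δ Γ v (.delayE A)) (hΓ : WfCtx Δ (Γ' ++ .tick (.cl v) :: Γ)) :
    SemTyped al Δ (Γ' ++ .tick (.cl v) :: Γ)
      (.adv (v.rename (fun i => i + numVars Γ'))) A := by
  intro n σ γ hσ hγ
  obtain ⟨ηN, ηL, κ, w, hN, Θ, η, rfl, hΘ, hγ', hη, hw, hκ⟩ :=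
    exists_beforeTick (ctxRel_drop hΓ.tickFree_of_append_tick.1 (hγ.mem_ctxRel hΓ))
  rw [Tm.subst, Tm.rename_subst]
  exact adv_mem_termRel hη hw (subst_mem_valRel_delayE hv ht fun _ => hγ') hΘ subset_rfl hκ

theorem semTyped_select {Γ Γ' : Ctx Chan} {θ : Clk Chan} {v₁ v₂ : Tm Chan} {A₁ A₂ : Ty 0}
    (hv₁ : IsValue v₁) (hv₂ : IsValue v₂) (ht₁ : HasType Δ Γ v₁ (.delayE A₁))
    (ht₂ : HasType Δ Γ v₂ (.delayE A₂)) (hθ : ClkEq θ (.join (.cl v₁) (.cl v₂)))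
    (hΓ : WfCtx Δ (Γ' ++ .tick θ :: Γ)) :
    SemTyped al Δ (Γ' ++ .tick θ :: Γ)
      (.select (v₁.rename (fun i => i + numVars Γ')) (v₂.rename (fun i => i + numVars Γ')))
      (.sum (.sum (.prod A₁ (.delayE A₂)) (.prod (.delayE A₁) A₂)) (.prod A₁ A₂)) := by
  intro n σ γ hσ hγ
  obtain ⟨ηN, ηL, κ, w, hN, Θ, η, rfl, hΘ, hγ', hη, hw, hκ⟩ :=
    exists_beforeTick (ctxRel_drop hΓ.tickFree_of_append_tick.1 (hγ.mem_ctxRel hΓ))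
  rw [hθ.eval_subst] at hΘ
  obtain ⟨Θ₁, Θ₂, hΘ₁, hΘ₂, rfl⟩ := Clk.eval_join_eq_some.1 hΘ
  rw [Tm.subst, Tm.rename_subst, Tm.rename_subst]
  exact select_mem_termRel hη hw (subst_mem_valRel_delayE hv₁ ht₁ fun _ => hγ')
    (subst_mem_valRel_delayE hv₂ ht₂ fun _ => hγ') hΘ₁ hΘ₂ hκ

theorem semTyped_advA {Γ Γ' : Ctx Chan} {θ : Clk Chan} {i : ℕ} {A : Ty 0}
    (ht : HasType Δ Γ (.var i) (.delayA A)) (hΓ : WfCtx Δ (Γ' ++ .tick θ :: Γ)) :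
    SemTyped al Δ (Γ' ++ .tick θ :: Γ) (.adv (.var (i + numVars Γ'))) A := by
  intro n σ γ hσ hγ
  obtain ⟨ηN, ηL, κ, w, hN, Θ, η, rfl, hΘ, hγ', -, hw, -⟩ :=
    exists_beforeTick (ctxRel_drop hΓ.tickFree_of_append_tick.1 (hγ.mem_ctxRel hΓ))
  have hv := (EnvRel.of_mem_ctxRel hγ').mem_valRel_of_var ht
  have hc := (closed_of_mem_valRel _ hv).1
  simp only [valRel, Tm.subst] at hv ⊢
  obtain ⟨-, b, hb, hv⟩ := hv
  rw [hb] at hc ⊢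
  refine ⟨hc, fun ι hι τ hτ => ?_⟩
  obtain ⟨τ', x, he, hx⟩ := hv.2 ι hι τ (Store.empty_tickLe (hτ.inputTyped hσ))
  exact ⟨τ', x, .adv_dfix he, hx⟩

theorem semTyped_fix {Γ : Ctx Chan} {t : Tm Chan} {A : Ty 0}
    (hT : HasType Δ Γ (.fix (t.rename (upRen (stabEmb Γ)))) A)
    (ht : SemTyped al Δ (.var (.delayA A) :: stabilize Γ) t A) :
    SemTyped al Δ Γ (.fix (t.rename (upRen (stabEmb Γ)))) A := by
  refine .of_eval hT fun n σ γ hσ hγ ι hι => ?_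
  have hc := hγ.closed_subst hT
  have hinst : ∀ v, ((t.rename (upRen (stabEmb Γ))).subst (upSub γ)).inst v =
      t.subst (scons v fun i => γ (stabEmb Γ i)) := by
    intro v
    rw [Tm.rename_subst, upSub_comp_upRen, Tm.inst_subst_upSub]
  simp only [Tm.subst] at hc ⊢
  generalize (t.rename (upRen (stabEmb Γ))).subst (upSub γ) = b at hinst hc
  have hunfold : ∀ m ≤ n, ∀ τ : Store Chan, τ.InputTyped Δ →
      .dfix b ∈ valRel al Δ (.delayA A) m τ → b.inst (.dfix b) ∈ termRel al Δ A m τ := by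
    intro m hm τ hτ hd
    rw [hinst]
    exact ht hτ
      (EnvRel.scons (.of_mem_ctxRel ((hγ.stableEnv.mono hm).mem_ctxRel_stabilize τ)) hd)
  -- the guarded recursion: at index `m + 1`, the unfolding is needed at index `m` only
  have hdfix : ∀ m ≤ n, ∀ τ : Store Chan, .dfix b ∈ valRel al Δ (.delayA A) m τ := by
    intro m
    induction m with
    | zero =>
      intro _ τ
      simp only [valRel]
      exact ⟨hc, b, rfl⟩
    | succ m ih =>
      intro hm τ
      have hm' := (Nat.le_succ m).trans hm
      simp only [valRel]
      exact ⟨hc, b, rfl, hunfold m hm' .empty trivial (ih hm' _)⟩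
  obtain ⟨σ', v, he, hv⟩ := (hunfold n le_rfl σ hσ (hdfix n le_rfl σ)).2 ι hι σ (.refl σ)
  exact ⟨σ', v, .fix he, hv⟩

theorem semTyped_box {Γ : Ctx Chan} {t : Tm Chan} {A : Ty 0}
    (ht : SemTyped al Δ (stabilize Γ) t A) :
    SemTyped al Δ Γ (.box (t.rename (stabEmb Γ))) (.box A) := by
  intro n σ γ hσ hγ
  refine mem_termRel_of_mem_valRel ?_
  simp only [valRel, Tm.subst]
  refine ⟨_, rfl, ?_⟩
  rw [Tm.rename_subst]
  exact ht trivial (.of_mem_ctxRel (hγ.stableEnv.mem_ctxRel_stabilize .empty))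

theorem semTyped_unbox {Γ : Ctx Chan} {t : Tm Chan} {A : Ty 0}
    (hT : HasType Δ Γ (.unbox t) A) (ht : SemTyped al Δ Γ t (.box A)) :
    SemTyped al Δ Γ (.unbox t) A := by
  refine .of_eval hT fun n σ γ hσ hγ ι hι => ?_
  obtain ⟨σ₁, v, he, hv, -, hσ₁, -⟩ := ht.exists_eval hσ hγ hι
  simp only [valRel] at hv
  obtain ⟨s, rfl, hs⟩ := hv
  obtain ⟨σ₂, w, he', hw⟩ := hs.2 ι hι σ₁ (Store.empty_tickLe hσ₁)
  exact ⟨σ₂, w, .unbox he he', hw⟩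

theorem semTyped_letIn {Γ : Ctx Chan} {s t : Tm Chan} {A B : Ty 0}
    (hT : HasType Δ Γ (.letIn s t) B) (hs : SemTyped al Δ Γ s A)
    (ht : SemTyped al Δ (.var A :: Γ) t B) : SemTyped al Δ Γ (.letIn s t) B := by
  refine .of_eval hT fun n σ γ hσ hγ ι hι => ?_
  obtain ⟨σ₁, v, he, hv, -, hσ₁, hγ₁⟩ := hs.exists_eval hσ hγ hι
  obtain ⟨σ₂, w, he', hw⟩ := ht.exists_eval_inst hσ₁ hγ₁ hv hι
  exact ⟨σ₂, w, .letIn he he', hw⟩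

theorem semTyped_pair {Γ : Ctx Chan} {s t : Tm Chan} {A B : Ty 0}
    (hT : HasType Δ Γ (.pair s t) (.prod A B)) (hs : SemTyped al Δ Γ s A)
    (ht : SemTyped al Δ Γ t B) : SemTyped al Δ Γ (.pair s t) (.prod A B) := by
  refine .of_eval hT fun n σ γ hσ hγ ι hι => ?_
  obtain ⟨σ₁, v, he, hv, -, hσ₁, hγ₁⟩ := hs.exists_eval hσ hγ hι
  obtain ⟨σ₂, w, he', hw, hle, -⟩ := ht.exists_eval hσ₁ hγ₁ hι
  simp only [valRel]
  exact ⟨σ₂, _, .pair he he', v, w, rfl, valRel_mono A le_rfl hle.gc_le hv, hw⟩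

theorem semTyped_fst {Γ : Ctx Chan} {t : Tm Chan} {A B : Ty 0} (hT : HasType Δ Γ (.fst t) A)
    (ht : SemTyped al Δ Γ t (.prod A B)) : SemTyped al Δ Γ (.fst t) A := by
  refine .of_eval hT fun n σ γ hσ hγ ι hι => ?_
  obtain ⟨σ', v, he, hv, -⟩ := ht.exists_eval hσ hγ hι
  simp only [valRel] at hv
  obtain ⟨v, w, rfl, hv, -⟩ := hv
  exact ⟨σ', v, .fst he, hv⟩

theorem semTyped_snd {Γ : Ctx Chan} {t : Tm Chan} {A B : Ty 0} (hT : HasType Δ Γ (.snd t) B)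
    (ht : SemTyped al Δ Γ t (.prod A B)) : SemTyped al Δ Γ (.snd t) B := by
  refine .of_eval hT fun n σ γ hσ hγ ι hι => ?_
  obtain ⟨σ', v, he, hv, -⟩ := ht.exists_eval hσ hγ hι
  simp only [valRel] at hv
  obtain ⟨v, w, rfl, -, hw⟩ := hv
  exact ⟨σ', w, .snd he, hw⟩

theorem semTyped_inl {Γ : Ctx Chan} {t : Tm Chan} {A B : Ty 0}
    (hT : HasType Δ Γ (.inl t) (.sum A B)) (ht : SemTyped al Δ Γ t A) :
    SemTyped al Δ Γ (.inl t) (.sum A B) := by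
  refine .of_eval hT fun n σ γ hσ hγ ι hι => ?_
  obtain ⟨σ', v, he, hv, -⟩ := ht.exists_eval hσ hγ hι
  simp only [valRel]
  exact ⟨σ', _, .inl he, .inl ⟨v, rfl, hv⟩⟩

theorem semTyped_inr {Γ : Ctx Chan} {t : Tm Chan} {A B : Ty 0}
    (hT : HasType Δ Γ (.inr t) (.sum A B)) (ht : SemTyped al Δ Γ t B) :
    SemTyped al Δ Γ (.inr t) (.sum A B) := by
  refine .of_eval hT fun n σ γ hσ hγ ι hι => ?_
  obtain ⟨σ', v, he, hv, -⟩ := ht.exists_eval hσ hγ hι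
  simp only [valRel]
  exact ⟨σ', _, .inr he, .inr ⟨v, rfl, hv⟩⟩

theorem semTyped_suc {Γ : Ctx Chan} {t : Tm Chan} (hT : HasType Δ Γ (.suc t) .nat)
    (ht : SemTyped al Δ Γ t .nat) : SemTyped al Δ Γ (.suc t) .nat := by
  refine .of_eval hT fun n σ γ hσ hγ ι hι => ?_
  obtain ⟨σ', v, he, hv, -⟩ := ht.exists_eval hσ hγ hι
  simp only [valRel] at hv ⊢
  obtain ⟨m, rfl⟩ := hv
  exact ⟨σ', _, .suc he, m + 1, rfl⟩

theorem semTyped_inp {Γ : Ctx Chan} {κ : Chan} {c : ChanKind} {A : Ty 0}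
    (hκ : Δ.decl κ = some (c, A)) (hc : c.isPush) :
    SemTyped al Δ Γ (.inp κ) (.delayE A) := by
  intro n σ γ _ _
  refine mem_termRel_of_mem_valRel ?_
  cases n <;> simp only [valRel] <;> exact .inr ⟨κ, c, rfl, hκ, hc⟩

theorem semTyped_buf {Γ : Ctx Chan} {κ : Chan} {c : ChanKind} {A : Ty 0}
    (hκ : Δ.decl κ = some (c, A)) (hc : c.isBuffered) : SemTyped al Δ Γ (.buf κ) A := by
  refine .of_eval (.buf hκ hc) fun n σ γ _ _ ι hι => ?_
  obtain ⟨v, hv, hval, ht⟩ := hι κ c A hκ hc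
  exact ⟨σ, v, .buf hv, mem_valRel_of_isValueType hval (Δ.valueType _ _ _ hκ) ht n σ⟩

theorem semTyped_into {Γ : Ctx Chan} {t : Tm Chan} {A : Ty 1}
    (hT : HasType Δ Γ (.into t) (.fix A)) (ht : SemTyped al Δ Γ t A.unfold) :
    SemTyped al Δ Γ (.into t) (.fix A) := by
  refine .of_eval hT fun n σ γ hσ hγ ι hι => ?_
  obtain ⟨σ', v, he, hv, -⟩ := ht.exists_eval hσ hγ hι
  simp only [valRel]
  exact ⟨σ', _, .into he, v, rfl, hv⟩

theorem semTyped_out {Γ : Ctx Chan} {t : Tm Chan} {A : Ty 1}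
    (hT : HasType Δ Γ (.out t) A.unfold) (ht : SemTyped al Δ Γ t (.fix A)) :
    SemTyped al Δ Γ (.out t) A.unfold := by
  refine .of_eval hT fun n σ γ hσ hγ ι hι => ?_
  obtain ⟨σ', v, he, hv, -⟩ := ht.exists_eval hσ hγ hι
  simp only [valRel] at hv
  obtain ⟨v, rfl, hv⟩ := hv
  exact ⟨σ', v, .out he, hv⟩

/-- The fundamental property, by induction on the typing derivation; the context need not be
well-formed. -/
theorem HasType.semTyped {Γ : Ctx Chan} {t : Tm Chan} {A : Ty 0} (h : HasType Δ Γ t A) :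
    SemTyped al Δ Γ t A :=
  HasType.rec (Δ := Δ)
    (motive_1 := fun _ _ => True)
    (motive_2 := fun _ _ _ => True)
    (motive_3 := fun Γ t A _ => SemTyped al Δ Γ t A)
    -- well-formed contexts and clocks
    trivial (fun _ _ => trivial) (fun _ _ _ _ _ => trivial) (fun _ _ _ _ => trivial)
    (fun _ _ _ => trivial)
    -- terms, in the order of the typing rules
    (fun hA hΓ _ => semTyped_var (.var hA hΓ))
    (@semTyped_unit _ _ _)
    (fun hs ht => semTyped_letIn (.letIn hs ht))
    (fun ht hΓ h => semTyped_lam (.lam ht hΓ) h hΓ)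
    (fun hs ht => semTyped_app (.app hs ht))
    (fun ht => semTyped_inl (.inl ht))
    (fun ht => semTyped_inr (.inr ht))
    (fun h₁ h₂ ht => semTyped_case (.case h₁ h₂ ht))
    (fun hs ht => semTyped_pair (.pair hs ht))
    (fun ht => semTyped_fst (.fst ht))
    (fun ht => semTyped_snd (.snd ht))
    (fun ht hθ h _ => semTyped_delay (.delay ht hθ) h hθ)
    (@semTyped_never _ _ _)
    semTyped_inp
    semTyped_buf
    (fun hv ht hΓ _ _ => semTyped_adv hv ht hΓ)
    (fun hv₁ hv₂ ht₁ ht₂ hθ hΓ _ _ _ => semTyped_select hv₁ hv₂ ht₁ ht₂ hθ hΓ)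
    (@semTyped_zero _ _ _)
    (fun ht => semTyped_suc (.suc ht))
    (fun hs ht hn => semTyped_natrec (.natrec hs ht hn))
    (fun ht => semTyped_fix (.fix ht))
    (fun ht hΓ _ _ => semTyped_advA ht hΓ)
    (fun _ => semTyped_box)
    (fun ht => semTyped_unbox (.unbox ht))
    (fun ht => semTyped_out (.out ht))
    (fun ht => semTyped_into (.into ht))
    h

end SemTyped

end AsyncRaTT

theorem mainTheorem1 {Chan : Type u} (al : AsyncRaTT.Allocator Chan)
    (Δ : AsyncRaTT.InputCtx Chan) (Γ : AsyncRaTT.Ctx Chan) (t : AsyncRaTT.Tm Chan)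
    (A : AsyncRaTT.Ty 0) (n : ℕ) (σ : AsyncRaTT.Store Chan) (γ : ℕ → AsyncRaTT.Tm Chan)
    (hσ : σ.InputTyped Δ) (hΓ : AsyncRaTT.WfCtx Δ Γ) (ht : AsyncRaTT.HasType Δ Γ t A)
    (hγ : γ ∈ AsyncRaTT.ctxRel al Δ Γ n σ) :
    t.subst γ ∈ AsyncRaTT.termRel al Δ A n σ := by
  exact ht.semTyped hσ (.of_mem_ctxRel hγ)
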